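/- **Setting.** Let $n=4^k$ and $N=\sqrt n=2^k$. The *$n$-MM problem* is to multiply two $N\times N$ matrices $A,B$ using only semiring operations. A *static algorithm* for it on $q=2^a$ processing elements $P_0,\dots,P_{q-1}$ is a fixed (input-independent) sequence of supersteps. In a superstep each processing element executes a straight-line sequence of semiring operations ($0$, $1$, $+$, $\cdot$) on cells of its own unbounded local memory and then sends messages, each carrying one semiring element, which are available after the superstep. A superstep has a label $i\ge 0$; in a superstep with label $i<a$ (an $i$-superstep) messages are exchanged only between processing elements whose indices agree in the $i$ most significant of their $a$ bits, and steps with labels $i\ge a$ are local computation. Initially some cells contain entries of $A$ and $B$ (the others contain $0$), and at the end designated cells contain the entries of $AB$, for all $A,B$ over every semiring. The *folding* on $q'=2^b<q$ processing elements lets $P_j$ carry out the operations of the $q/q'$ consecutive old processing elements starting with the $j(q/q')$-th one; labels are kept, so that supersteps with label $\ge b$ become local computation. The *degree* of a superstep is the maximum, over all processing elements, of the number of messages sent to, or received from, other processing elements (whichever is larger). $F^i$ is the sum of the degrees of the $i$-supersteps and $S^i$ is their number. For $g=(g_0,\dots,g_{\log_2 p-1})$ with $g_i>0$ and $\ell=(\ell_0,\dots,\ell_{\log_2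 p-1})$ with $\ell_i\ge0$, the *communication time* of an algorithm on the machine D-BSP$(p,g,\ell)$ with $p$ processors is $D=\sum_{i=0}^{\log_2 p-1}(F^i g_i+S^i\ell_i)$. **Class $\mathscr C$.** A static $n$-MM algorithm on $q$ processing elements belongs to $\mathscr C$ if (i) no entry of $A$ or $B$ is initially replicated; (ii) no processing element computes more than $n^{3/2}/\min\{q,11^3\}$ multiplicative terms, i.e. (symbolic) products $A[i,k]\cdot B[k,j]$; (iii) all its foldings on $q'$ processing elements, $2\le q'<q$ a power of two, belong to $\mathscr C$. For $0<\beta\le1$, an algorithm on $p$ processors is *$\beta$-optimal on D-BSP$(p,g,\ell)$ with respect to $\mathscr C$* (for size $n$) if it belongs to $\mathscr C$ and its communication time is at most $1/\beta$ times that of every algorithm in $\mathscr C$ for $p$ processors and size $n$. **The network-oblivious algorithm.** It is designed for $n$ virtual processors $\mathrm{VP}_0,\dots,\mathrm{VP}_{n-1}$, with $A,B,C=AB$ evenly distributed, one entry of each per processor, in row-major order. On recursion level $0\le i<\lceil(\log_2 n)/3\rceil$ there are $8^i$ independent $(n/4^i)$-MM subproblems, each owning a segment of $n/8^i$ consecutive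 virtual processors over which its three matrices are spread evenly in row-major order. In a $3i$-superstep, for each subproblem and each $(h,k,l)\in\{0,1\}^3$, copies of the quadrants $A_{hl}$ and $B_{lk}$ are spread evenly over the $(4h+2k+l)$-th eighth of the segment. These eighths then compute in parallel, recursively, $M_{hkl}=A_{hl}B_{lk}$. In a further $3i$-superstep the owner of $C[r,c]$ in the quadrant $C_{hk}$ collects the corresponding entries of $M_{hk0}$ and $M_{hk1}$, which it then adds. (If $\log_2 n$ is not divisible by $3$, then on the last level several of the eight sub-subproblems share one virtual processor.) The subproblems of level $\lceil(\log_2 n)/3\rceil$ are solved sequentially within single virtual processors. The last additions (for $n=1$, the sequential product) are done in a final $0$-superstep. In every $3i$-superstep, $\mathrm{VP}_j$ moreover sends $2^i$ dummy messages to $\mathrm{VP}_{j+n/2^{3i+1}}$, for $0\le j<n/2^{3i+1}$. **Statement.** The above algorithm is $\Theta(1)$-optimal with respect to $\mathscr C$ on every D-BSP$(p,g,\ell)$ with $1<p\le n$, non-increasing $g_i$ and $\ell_i/g_i$, and $\ell_0/g_0=O(n/p)$. That is, for every constant $K>0$ there is a constant $\beta\in(0,1]$, depending on $K$ only, such that for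 every $n=4^k$, every power of two $p$ with $1<p\le n$, and all $g,\ell$ as above with $g_0\ge g_1\ge\dots$, $\ell_0/g_0\ge\ell_1/g_1\ge\dots$ and $\ell_0/g_0\le K\,n/p$, the folding of the algorithm on $p$ processors is $\beta$-optimal on D-BSP$(p,g,\ell)$ with respect to $\mathscr C$. -/

import Mathlib

namespace NetworkOblivious

/-! ### Straight-line semiring programs on a machine with distributed memory -/

/-- An entry of one of the two input matrices `A`, `B` of size `N × N`. -/
inductive Entry (N : ℕ) where
  | a (i j : Fin N) : Entry N
  | b (i j : Fin N) : Entry N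

/-- A local instruction: a semiring operation (the two constants, sum, product) with operands and
result in memory cells of type `γ`; `d` is the destination. -/
inductive Instr (γ : Type) where
  | zero (d : γ) : Instr γ
  | one (d : γ) : Instr γ
  | add (d x y : γ) : Instr γ
  | mul (d x y : γ) : Instr γ

/-- A superstep: local code, then messages, then a barrier `sync(label)`. A message `(x, y)` carries
the content of cell `x` (at the processing element hosting `x`) to cell `y`
(at the processing element hosting `y`). -/
structure Superstep (γ : Type) where
  label : ℕ
  code : List (Instr γ)
  msgs : List (γ × γ)

/-- A static algorithm for the multiplication of two `N × N` matrices that uses only semiring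
operations. `home c` is the index of the processing element whose local memory contains the
cell `c`; `init c` is the input entry initially stored in `c`, if any (the other cells initially
contain `0`); `out i j` is the cell that finally contains the entry `(i, j)` of the product. -/
structure Program (N : ℕ) where
  Cell : Type
  [decEq : DecidableEq Cell]
  home : Cell → ℕ
  init : Cell → Option (Entry N)
  out : Fin N → Fin N → Cell
  steps : List (Superstep Cell)

attribute [instance] Program.decEq

section Semantics

/-- Effect of an instruction on a memory with contents in a semiring. -/
def Instr.exec {γ : Type} [DecidableEq γ] {R : Type} [Semiring R] (m : γ → R) :
    Instr γ → (γ → R)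
  | .zero d => Function.update m d 0
  | .one d => Function.update m d 1
  | .add d x y => Function.update m d (m x + m y)
  | .mul d x y => Function.update m d (m x * m y)

/-- Effect of a list of instructions, executed one after the other. -/
def execCode {γ : Type} [DecidableEq γ] {R : Type} [Semiring R] (m : γ → R)
    (code : List (Instr γ)) : γ → R :=
  code.foldl Instr.exec m

/-- Effect of a superstep: the code is executed, and then all messages, which carry the contents
that the source cells have after the local code, are delivered. -/
def Superstep.exec {γ : Type} [DecidableEq γ] {R : Type} [Semiring R] (m : γ → R)
    (s : Superstep γ) : γ → R :=
  s.msgs.foldl (fun m' e => Function.update m' e.2 (execCode m s.code e.1)) (execCode m s.code)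

/-- Effect of a list of supersteps. -/
def execSteps {γ : Type} [DecidableEq γ] {R : Type} [Semiring R] (m : γ → R)
    (steps : List (Superstep γ)) : γ → R :=
  steps.foldl Superstep.exec m

/-- The initial memory when the input entry `x` has the value `val x`. -/
def Program.initMem {N : ℕ} (P : Program N) {R : Type} [Semiring R] (val : Entry N → R) :
    P.Cell → R :=
  fun c => match P.init c with
    | none => 0
    | some x => val x

/-- The values of the input entries for the input matrices `A`, `B`. -/
def entryVal {N : ℕ} {R : Type} (A B : Matrix (Fin N) (Fin N) R) : Entry N → R
  | .a i j => A i j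
  | .b i j => B i j

/-- The program multiplies any two `N × N` matrices over any semiring. -/
def Program.Correct {N : ℕ} (P : Program N) : Prop :=
  ∀ (R : Type) [Semiring R] (A B : Matrix (Fin N) (Fin N) R) (i j : Fin N),
    execSteps (P.initMem (entryVal A B)) P.steps (P.out i j) = (A * B) i j

end Semantics

section Machine

/-- `P` is a program for a machine with `2 ^ a` processing elements: every cell is in one of the
local memories, an instruction involves cells of one local memory only, and a message of a superstep
with label `i` stays within a cluster of processing elements whose indices share the `i` most
significant of their `a` bits. A step whose label is at least `a` thus involves no
communication at all: it is local computation, and it is not charged below. -/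
structure Program.Valid {N : ℕ} (P : Program N) (a : ℕ) : Prop where
  home_lt : ∀ c, P.home c < 2 ^ a
  code_local : ∀ s ∈ P.steps, ∀ I ∈ s.code,
    match I with
    | .zero _ => True
    | .one _ => True
    | .add d x y => P.home x = P.home d ∧ P.home y = P.home d
    | .mul d x y => P.home x = P.home d ∧ P.home y = P.home d
  msgs_cluster : ∀ s ∈ P.steps, ∀ e ∈ s.msgs,
    P.home e.1 / 2 ^ (a - s.label) = P.home e.2 / 2 ^ (a - s.label)

/-- Folding of a program for `2 ^ a` processing elements onto `2 ^ (a - e)` processing elements: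
the processing element `j` carries out the operations of the `2 ^ e` consecutively numbered
old ones starting with `j * 2 ^ e`. Supersteps keep their labels. -/
def Program.fold {N : ℕ} (P : Program N) (e : ℕ) : Program N :=
  { P with home := fun c => P.home c / 2 ^ e }

/-- Degree of a superstep on `2 ^ a` processing elements: the maximum number of messages that a
processing element sends to, or receives from, the other ones. -/
def Program.degree {N : ℕ} (P : Program N) (a : ℕ) (s : Superstep P.Cell) : ℕ :=
  (Finset.range (2 ^ a)).sup fun r =>
    max (s.msgs.countP fun e => P.home e.1 = r ∧ P.home e.2 ≠ r)
      (s.msgs.countP fun e => P.home e.2 = r ∧ P.home e.1 ≠ r)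

/-- The list of the supersteps with label `i`. -/
def Program.stepsWithLabel {N : ℕ} (P : Program N) (i : ℕ) : List (Superstep P.Cell) :=
  P.steps.filter fun s => s.label = i

/-- `S^i`: the number of supersteps with label `i`. -/
def Program.numSteps {N : ℕ} (P : Program N) (i : ℕ) : ℕ :=
  (P.stepsWithLabel i).length

/-- `F^i`: the cumulative degree of the supersteps with label `i`. -/
def Program.cumDegree {N : ℕ} (P : Program N) (a i : ℕ) : ℕ :=
  ((P.stepsWithLabel i).map (P.degree a)).sum

/-- The communication time on the D-BSP with `2 ^ a` processors and parameter vectors `g`, `ℓ`. -/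
noncomputable def Program.commTime {N : ℕ} (P : Program N) (a : ℕ) (g ℓ : Fin a → ℝ) : ℝ :=
  ∑ i : Fin a, ((P.cumDegree a i : ℝ) * g i + (P.numSteps i : ℝ) * ℓ i)

/-- `P` is a member of the class `𝒞` of algorithms for a D-BSP with `2 ^ a` processors and
parameter vectors `g`, `ℓ`, and `β`-optimal on this machine with respect to `𝒞`
(for one input size; `𝒞` contains the algorithms for this size). -/
def IsOptimal {N : ℕ} (𝒞 : Program N → Prop) (a : ℕ) (g ℓ : Fin a → ℝ) (β : ℝ)
    (P : Program N) : Prop :=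
  𝒞 P ∧ ∀ Q : Program N, 𝒞 Q → P.commTime a g ℓ ≤ (1 / β) * Q.commTime a g ℓ

end Machine

section MMClass

/-- No entry of the input matrices is initially stored in more than one cell. -/
def Program.NoReplication {N : ℕ} (P : Program N) : Prop :=
  ∀ (c c' : P.Cell) (x : Entry N), P.init c = some x → P.init c' = some x → c = c'

/-- The initial memory of the symbolic execution, in the free semiring on the input entries. -/
noncomputable def Program.symInit {N : ℕ} (P : Program N) : P.Cell → FreeAlgebra ℕ (Entry N) :=
  P.initMem (FreeAlgebra.ι ℕ)

/-- The triples `(i, k, j)` such that the processing element `r` computes the multiplicative term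
`A[i,k] * B[k,j]`: at some point of the execution it multiplies the contents of two of its
cells, and these contents are (as symbolic expressions) `A[i,k]` and `B[k,j]`. -/
def Program.termsComputed {N : ℕ} (P : Program N) (r : ℕ) : Set (Fin N × Fin N × Fin N) :=
  {τ | ∃ (before after : List (Superstep P.Cell)) (s : Superstep P.Cell)
      (pre post : List (Instr P.Cell)) (d x y : P.Cell),
      P.steps = before ++ s :: after ∧ s.code = pre ++ Instr.mul d x y :: post ∧
      P.home d = r ∧
      execCode (execSteps P.symInit before) pre x = FreeAlgebra.ι ℕ (Entry.a τ.1 τ.2.1) ∧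
      execCode (execSteps P.symInit before) pre y = FreeAlgebra.ι ℕ (Entry.b τ.2.1 τ.2.2)}

/-- The class of static algorithms, on `2 ^ a` processing elements, for the `n`-MM problem with
`n = N ^ 2`, so that `n ^ (3 / 2) = N ^ 3`: (i) inputs are not replicated; (ii) no processing
element computes more than `n ^ (3 / 2) / min (2 ^ a) (11 ^ 3)` multiplicative terms; (iii) all
foldings on `2 ^ b` processing elements, `2 ≤ 2 ^ b < 2 ^ a`, belong to the class. -/
inductive MMClass {N : ℕ} : ℕ → Program N → Prop where
  | intro (a : ℕ) (P : Program N) (valid : P.Valid a) (correct : P.Correct)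
      (noReplication : P.NoReplication)
      (load : ∀ r < 2 ^ a, ((P.termsComputed r).ncard : ℝ) ≤ (N : ℝ) ^ 3 / min (2 ^ a) (11 ^ 3))
      (fold_mem : ∀ b, 1 ≤ b → b < a → MMClass b (P.fold (a - b))) :
      MMClass a P

end MMClass

/-! ### The recursive network-oblivious algorithm, `n = 4 ^ k`, on `n` virtual processors -/

section Algorithm

/-- `⌈(log₂ n) / 3⌉`, the number of levels of the recursion. -/
def mmDepth (k : ℕ) : ℕ := (2 * k + 2) / 3

/-- Memory cells. The `8 ^ i` subproblems of the recursion level `i` are numbered by `t`; each one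
multiplies two square matrices of dimension `2 ^ (k - i)`, and `(r, c)` is a position in them.
Cells `a`, `b`, `m` are for the entries of the factors and of the product, `part` with
`l ∈ {0, 1}` is for the two contributions to an entry of the product that come from the next
level, `tmp` is an auxiliary cell, and `dummy j` is a cell of the `j`-th virtual processor. -/
inductive MMCell where
  | a (i t r c : ℕ) : MMCell
  | b (i t r c : ℕ) : MMCell
  | m (i t r c : ℕ) : MMCell
  | part (i t l r c : ℕ) : MMCell
  | tmp (i t r c : ℕ) : MMCell
  | dummy (j : ℕ) : MMCell
deriving DecidableEq

/-- The virtual processor responsible for the position `(r, c)` of the subproblem `t` of level `i`.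
The subproblem owns a segment of `n / 8 ^ i` consecutive virtual processors, over which its
positions are spread evenly in row-major order, `2 ^ i` positions each. (If `8 ^ i > n`, which
happens on the last level only, `8 ^ i / n` subproblems share one virtual processor. The final
`%` has no effect on positions in range.) -/
def mmOwner (k i t r c : ℕ) : ℕ :=
  ((t * 4 ^ (k - i) + r * 2 ^ (k - i) + c) / 2 ^ i) % 4 ^ k

def mmHome (k : ℕ) : MMCell → ℕ
  | .a i t r c => mmOwner k i t r c
  | .b i t r c => mmOwner k i t r c
  | .m i t r c => mmOwner k i t r c
  | .part i t _ r c => mmOwner k i t r c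
  | .tmp i t r c => mmOwner k i t r c
  | .dummy j => j % 4 ^ k

def mmInit (k : ℕ) : MMCell → Option (Entry (2 ^ k))
  | .a 0 0 r c => if h : r < 2 ^ k ∧ c < 2 ^ k then some (.a ⟨r, h.1⟩ ⟨c, h.2⟩) else none
  | .b 0 0 r c => if h : r < 2 ^ k ∧ c < 2 ^ k then some (.b ⟨r, h.1⟩ ⟨c, h.2⟩) else none
  | _ => none

/-- In a superstep with label `3 * i`, for `j < n / 2 ^ (3 * i + 1)`, the `j`-th virtual
processor sends `2 ^ i` dummy messages to the `(j + n / 2 ^ (3 * i + 1))`-th one. -/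
def mmDummy (k i : ℕ) : List (MMCell × MMCell) :=
  (List.range (4 ^ k / 2 ^ (3 * i + 1))).flatMap fun j =>
    List.replicate (2 ^ i) (.dummy j, .dummy (j + 4 ^ k / 2 ^ (3 * i + 1)))

/-- Applies `f t h k' l r c` to all subproblems `t` of level `i`, all `h, k', l ∈ {0, 1}`
and all positions `(r, c)` of a quadrant. -/
def mmForAll {α : Type} (k i : ℕ) (f : ℕ → ℕ → ℕ → ℕ → ℕ → ℕ → List α) : List α :=
  (List.range (8 ^ i)).flatMap fun t =>
    (List.range 2).flatMap fun h => (List.range 2).flatMap fun k' => (List.range 2).flatMap fun l =>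
      (List.range (2 ^ (k - (i + 1)))).flatMap fun r =>
        (List.range (2 ^ (k - (i + 1)))).flatMap fun c => f t h k' l r c

/-- The distribution of the inputs on level `i`: the quadrants `A_{h l}` and `B_{l k'}` of the
subproblem `t` become the factors of its subproblem `(h, k', l)`, which has the number
`8 * t + (4 * h + 2 * k' + l)` on level `i + 1`. -/
def mmDown (k i : ℕ) : Superstep MMCell where
  label := 3 * i
  code := []
  msgs := (mmForAll k i fun t h k' l r c =>
      [(.a i t (h * 2 ^ (k - (i + 1)) + r) (l * 2 ^ (k - (i + 1)) + c),
          .a (i + 1) (8 * t + (4 * h + 2 * k' + l)) r c),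
        (.b i t (l * 2 ^ (k - (i + 1)) + r) (k' * 2 ^ (k - (i + 1)) + c),
          .b (i + 1) (8 * t + (4 * h + 2 * k' + l)) r c)])
    ++ mmDummy k i

/-- Local code that completes the products on level `i`: on the last level, the sequential
multiplication; on the other ones, the sum of the two contributions to each entry. -/
def mmCode (k i : ℕ) : List (Instr MMCell) :=
  (List.range (8 ^ i)).flatMap fun t => (List.range (2 ^ (k - i))).flatMap fun r =>
    (List.range (2 ^ (k - i))).flatMap fun c =>
      if i = mmDepth k then
        .zero (.m i t r c) :: (List.range (2 ^ (k - i))).flatMap fun s =>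
          [.mul (.tmp i t r c) (.a i t r s) (.b i t s c),
            .add (.m i t r c) (.m i t r c) (.tmp i t r c)]
      else [.add (.m i t r c) (.part i t 0 r c) (.part i t 1 r c)]

/-- The products of level `i + 1` are completed and collected on level `i`. -/
def mmUp (k i : ℕ) : Superstep MMCell where
  label := 3 * i
  code := mmCode k (i + 1)
  msgs := (mmForAll k i fun t h k' l r c =>
      [(.m (i + 1) (8 * t + (4 * h + 2 * k' + l)) r c,
          .part i t l (h * 2 ^ (k - (i + 1)) + r) (k' * 2 ^ (k - (i + 1)) + c))])
    ++ mmDummy k i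

/-- The last superstep, where the entries of the product are completed. -/
def mmFinal (k : ℕ) : Superstep MMCell where
  label := 0
  code := mmCode k 0
  msgs := mmDummy k 0

/-- The recursive network-oblivious algorithm for the `n`-MM problem, `n = 4 ^ k`, on `n` virtual
processors. The subproblems of one level are solved in parallel. -/
def mmProgram (k : ℕ) : Program (2 ^ k) where
  Cell := MMCell
  home := mmHome k
  init := mmInit k
  out i j := .m 0 0 i j
  steps := (List.range (mmDepth k)).map (mmDown k)
    ++ ((List.range (mmDepth k)).reverse.map (mmUp k) ++ [mmFinal k])

end Algorithm

end NetworkOblivious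

open NetworkOblivious

/-! Put p = 2^a and let w(3i) = 2^i, w = 0 on the other labels. Up to constant factors, (n/p) · Σ
w(i) g_i bounds the communication time of every algorithm of the class from below and that of the
recursive algorithm from above; the quotient of the constants, 8100 (15 + 3K), is 1/β.

Lower bound. A program is run symbolically in the free semiring over ℕ. As nothing cancels there, an
input entry is never created by arithmetic, and a partial sum of an output entry arises only from
its multiplicative terms (`eq_ι_of_mul_eq_ι`, `IsPartialSum.of_mul`). Hence a processing element
that computes a term A[i,k]B[k,j] holds both operands initially or receives them, and for each term
some such element also hosts C[i,j] finally or sends a partial sum of it. If H is the total degree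
and x_r terms are charged to element r, the discrete Loomis-Whitney inequality
(`card_sq_le_card_projections`) gives x_r² ≤ (α_r + H)(β_r + H)(γ_r + H), where α_r, β_r, γ_r count
the entries of A, B, C at home at r and sum to at most N² each. Since the x_r add up to at least N³
and condition (ii) limits each of them, H ≥ n/(8100 · 4^j) on 2^(3j+1) elements
(`MMClass.totalDegree_ge`).

Applying this to all foldings of an algorithm on p processors bounds the partial sums of its F^i,
because folding 2^e elements together multiplies degrees by at most 2^e
(`MMClass.sum_cumDegree_ge`). These partial sums dominate those of (n/(8100 p)) w(i), so summation
by parts against the non-increasing g gives `MMClass.commTime_ge`.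

Upper bound. On level i a virtual processor owns 2^i positions of its subproblem, so a 3i-superstep
has degree at most 5 · 2^i · n/p after folding. Each label occurs at most three times, and ℓ_i ≤ K
(n/p) g_i absorbs the latencies (`commTime_mmProgram_le`). Membership in the class
(`mmProgram_fold_mem`) combines correctness of the recursion, locality of its messages, and perfect
balance of the multiplicative terms. -/

namespace NetworkOblivious

/-! ### Coefficients in the free semiring: absence of cancellation. -/

section Coefficients

variable {X : Type}

/-- The coefficient of a word in an element of the free semiring. -/
noncomputable def coef (V : FreeAlgebra ℕ X) (w : FreeMonoid X) : ℕ :=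
  (FreeAlgebra.equivMonoidAlgebraFreeMonoid V).coeff w

theorem coef_ext {V W : FreeAlgebra ℕ X} (h : ∀ w, coef V w = coef W w) : V = W := by
  apply FreeAlgebra.equivMonoidAlgebraFreeMonoid.injective
  ext w
  exact h w

@[simp] theorem coef_zero (w : FreeMonoid X) : coef (0 : FreeAlgebra ℕ X) w = 0 := by
  simp [coef]

@[simp] theorem coef_add (V W : FreeAlgebra ℕ X) (w : FreeMonoid X) :
    coef (V + W) w = coef V w + coef W w := by
  simp [coef, MonoidAlgebra.coeff_add]

open Classical in
theorem coef_one (w : FreeMonoid X) :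
    coef (1 : FreeAlgebra ℕ X) w = if w = 1 then 1 else 0 := by
  simp only [coef, map_one, MonoidAlgebra.one_def, MonoidAlgebra.coeff_single, Finsupp.single_apply]
  exact if_congr eq_comm rfl rfl

open Classical in
theorem coef_ι (x : X) (w : FreeMonoid X) :
    coef (FreeAlgebra.ι ℕ x) w = if w = FreeMonoid.of x then 1 else 0 := by
  simp only [coef, FreeAlgebra.equivMonoidAlgebraFreeMonoid, AlgEquiv.ofAlgHom_apply,
    FreeAlgebra.lift_ι_apply, MonoidAlgebra.of_apply, MonoidAlgebra.coeff_single, Finsupp.single_apply]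
  exact if_congr eq_comm rfl rfl

/-- The left side is one of the summands of the convolution, and all summands are natural numbers.
-/
theorem coef_mul_le (V W : FreeAlgebra ℕ X) (u v : FreeMonoid X) :
    coef V u * coef W v ≤ coef (V * W) (u * v) := by
  classical
  simp only [coef, map_mul, MonoidAlgebra.coeff_mul, Finsupp.sum]
  set f := (FreeAlgebra.equivMonoidAlgebraFreeMonoid V).coeff
  set g := (FreeAlgebra.equivMonoidAlgebraFreeMonoid W).coeff
  by_cases hu : f u = 0
  · simp [hu]
  by_cases hv : g v = 0
  · simp [hv]
  refine le_trans ?_ (Finset.single_le_sum (fun _ _ => Nat.zero_le _)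
    (Finsupp.mem_support_iff.2 hu))
  refine le_trans ?_ (Finset.single_le_sum (fun _ _ => Nat.zero_le _)
    (Finsupp.mem_support_iff.2 hv))
  simp

theorem exists_of_coef_mul_ne_zero {V W : FreeAlgebra ℕ X} {w : FreeMonoid X}
    (h : coef (V * W) w ≠ 0) : ∃ u v, u * v = w ∧ coef V u ≠ 0 ∧ coef W v ≠ 0 := by
  classical
  simp only [coef, map_mul, MonoidAlgebra.coeff_mul, Finsupp.sum] at h
  obtain ⟨u, hu, h⟩ := Finset.exists_ne_zero_of_sum_ne_zero h
  obtain ⟨v, hv, h⟩ := Finset.exists_ne_zero_of_sum_ne_zero h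
  refine ⟨u, v, ?_, Finsupp.mem_support_iff.1 hu, Finsupp.mem_support_iff.1 hv⟩
  by_contra hne
  simp [hne] at h

theorem mul_eq_of {u v : FreeMonoid X} {x : X} (h : u * v = FreeMonoid.of x) :
    (u = FreeMonoid.of x ∧ v = 1) ∨ (u = 1 ∧ v = FreeMonoid.of x) := by
  have h' : (FreeMonoid.toList u ++ FreeMonoid.toList v : List X) = [x] := h
  rcases List.append_eq_singleton_iff.1 h' with ⟨h1, h2⟩ | ⟨h1, h2⟩
  · exact Or.inr ⟨h1, h2⟩
  · exact Or.inl ⟨h1, h2⟩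

theorem mul_eq_of_mul_of {u v : FreeMonoid X} {x y : X}
    (h : u * v = FreeMonoid.of x * FreeMonoid.of y) :
    (u = 1 ∧ v = FreeMonoid.of x * FreeMonoid.of y) ∨ (u = FreeMonoid.of x ∧ v = FreeMonoid.of y) ∨
      (u = FreeMonoid.of x * FreeMonoid.of y ∧ v = 1) := by
  have h' : (FreeMonoid.toList u ++ FreeMonoid.toList v : List X) = [x, y] := h
  rcases hu : FreeMonoid.toList u with _ | ⟨a, _ | ⟨b, l⟩⟩
  · rw [hu] at h'
    exact Or.inl ⟨hu, h'⟩
  · rw [hu] at h'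
    simp only [List.cons_append, List.nil_append, List.cons.injEq] at h'
    refine Or.inr (Or.inl ⟨?_, h'.2⟩)
    rw [h'.1] at hu
    exact hu
  · rw [hu] at h'
    simp only [List.cons_append, List.cons.injEq, List.append_eq_nil_iff] at h'
    obtain ⟨rfl, rfl, rfl, h4⟩ := h'
    exact Or.inr (Or.inr ⟨hu, h4⟩)

theorem of_mul_of_inj {x y x' y' : X}
    (h : FreeMonoid.of x * FreeMonoid.of y = FreeMonoid.of x' * FreeMonoid.of y') :
    x = x' ∧ y = y' := by
  have h' : [x, y] = [x', y'] := h
  simpa using h'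

theorem of_mul_of_ne_of (x y z : X) :
    FreeMonoid.of x * FreeMonoid.of y ≠ FreeMonoid.of z := by
  intro h
  have h' : [x, y] = [z] := h
  simp at h'

theorem of_mul_of_ne_one (x y : X) : FreeMonoid.of x * FreeMonoid.of y ≠ 1 := by
  intro h
  have h' : [x, y] = [] := h
  simp at h'

theorem eq_ι_of_coef {V : FreeAlgebra ℕ X} {x : X} (h1 : coef V (FreeMonoid.of x) ≠ 0)
    (hle : ∀ w, coef V w ≤ coef (FreeAlgebra.ι ℕ x) w) : V = FreeAlgebra.ι ℕ x := by
  apply coef_ext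
  intro w
  refine le_antisymm (hle w) ?_
  rw [coef_ι]
  split_ifs with hw
  · rw [hw]; exact Nat.one_le_iff_ne_zero.2 h1
  · exact Nat.zero_le _

theorem ι_ne_zero' (x : X) : (0 : FreeAlgebra ℕ X) ≠ FreeAlgebra.ι ℕ x := by
  intro h
  have := congrArg (fun V => coef V (FreeMonoid.of x)) h
  simp [coef_ι] at this

theorem ι_ne_one' (x : X) : (1 : FreeAlgebra ℕ X) ≠ FreeAlgebra.ι ℕ x := by
  intro h
  have := congrArg (fun V => coef V (FreeMonoid.of x)) h
  simp [coef_ι, coef_one] at this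

/-- The coefficient 1 of the word x cannot be shared between two natural numbers, and no other word
can occur in either summand. -/
theorem eq_ι_of_add_eq_ι {V W : FreeAlgebra ℕ X} {x : X} (h : V + W = FreeAlgebra.ι ℕ x) :
    V = FreeAlgebra.ι ℕ x ∨ W = FreeAlgebra.ι ℕ x := by
  have h1 : coef V (FreeMonoid.of x) + coef W (FreeMonoid.of x) = 1 := by
    rw [← coef_add, h, coef_ι, if_pos rfl]
  have hle : ∀ w, coef V w + coef W w = coef (FreeAlgebra.ι ℕ x) w := fun w => by
    rw [← coef_add, h]
  rcases Nat.eq_zero_or_pos (coef V (FreeMonoid.of x)) with h0 | h0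
  · exact Or.inr (eq_ι_of_coef (by omega) fun w => by have := hle w; omega)
  · exact Or.inl (eq_ι_of_coef (by omega) fun w => by have := hle w; omega)

/-- A one-letter word factors only trivially, so one factor has a positive constant term; this makes
the other factor at most the product, coefficient by coefficient. Thus multiplication cannot produce
an entry that is not already there. -/
theorem eq_ι_of_mul_eq_ι {V W : FreeAlgebra ℕ X} {x : X} (h : V * W = FreeAlgebra.ι ℕ x) :
    V = FreeAlgebra.ι ℕ x ∨ W = FreeAlgebra.ι ℕ x := by
  have h1 : coef (V * W) (FreeMonoid.of x) ≠ 0 := by simp [h, coef_ι]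
  obtain ⟨u, v, huv, hu, hv⟩ := exists_of_coef_mul_ne_zero h1
  rcases mul_eq_of huv with ⟨rfl, rfl⟩ | ⟨rfl, rfl⟩
  · refine Or.inl (eq_ι_of_coef hu fun w => ?_)
    have := coef_mul_le V W w 1
    rw [h, mul_one] at this
    exact (Nat.le_mul_of_pos_right _ (Nat.pos_of_ne_zero hv)).trans this
  · refine Or.inr (eq_ι_of_coef hv fun w => ?_)
    have := coef_mul_le V W 1 w
    rw [h, one_mul] at this
    exact (Nat.le_mul_of_pos_left _ (Nat.pos_of_ne_zero hu)).trans this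

end Coefficients

/-! ### Partial sums of an entry of the product. -/

section PartialSums

variable {N : ℕ}

/-- The word `A[i,k] B[k,j]`. -/
def termWord (i k j : Fin N) : FreeMonoid (Entry N) :=
  FreeMonoid.of (Entry.a i k) * FreeMonoid.of (Entry.b k j)

/-- `V` is a sum of distinct terms of the entry `(i, j)` of the product, one of them being
`A[i,k] B[k,j]`. -/
structure IsPartialSum (i k j : Fin N) (V : FreeAlgebra ℕ (Entry N)) : Prop where
  le_one : ∀ w, coef V w ≤ 1
  support : ∀ w, coef V w ≠ 0 → ∃ k', w = termWord i k' j
  ne_zero : coef V (termWord i k j) ≠ 0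

theorem termWord_inj {i k j i' k' j' : Fin N} (h : termWord i k j = termWord i' k' j') :
    i = i' ∧ k = k' ∧ j = j' := by
  have := of_mul_of_inj h
  simp only [Entry.a.injEq, Entry.b.injEq] at this
  tauto

/-- This lets one message be charged to one output entry only. -/
theorem IsPartialSum.index_unique {i k j i' k' j' : Fin N} {V : FreeAlgebra ℕ (Entry N)}
    (h : IsPartialSum i k j V) (h' : IsPartialSum i' k' j' V) : i = i' ∧ j = j' := by
  obtain ⟨k'', hk⟩ := h'.support _ h.ne_zero
  have := termWord_inj hk
  tauto

theorem IsPartialSum.of_le {i k j : Fin N} {V W : FreeAlgebra ℕ (Entry N)}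
    (h : IsPartialSum i k j V) (hle : ∀ w, coef W w ≤ coef V w)
    (hne : coef W (termWord i k j) ≠ 0) : IsPartialSum i k j W where
  le_one w := (hle w).trans (h.le_one w)
  support w hw := h.support w fun h0 => hw (Nat.le_zero.1 (h0 ▸ hle w))
  ne_zero := hne

theorem not_isPartialSum_zero (i k j : Fin N) : ¬ IsPartialSum i k j 0 :=
  fun h => h.ne_zero (coef_zero _)

theorem not_isPartialSum_one (i k j : Fin N) : ¬ IsPartialSum i k j 1 := by
  intro h
  apply h.ne_zero
  rw [coef_one]; exact if_neg (of_mul_of_ne_one _ _)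

theorem not_isPartialSum_ι (i k j : Fin N) (x : Entry N) :
    ¬ IsPartialSum i k j (FreeAlgebra.ι ℕ x) := by
  intro h
  apply h.ne_zero
  rw [coef_ι]; exact if_neg (of_mul_of_ne_of _ _ _)

theorem IsPartialSum.of_add {i k j : Fin N} {V W : FreeAlgebra ℕ (Entry N)}
    (h : IsPartialSum i k j (V + W)) : IsPartialSum i k j V ∨ IsPartialSum i k j W := by
  by_cases hV : coef V (termWord i k j) = 0
  · refine Or.inr (h.of_le (fun w => by simp) fun hW => h.ne_zero ?_)
    simp [hV, hW]
  · exact Or.inl (h.of_le (fun w => by simp) hV)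

/-- A two-letter word splits in three ways. In the trivial splittings one factor has a positive
constant term, so the other one inherits the property. In the middle splitting, the restrictions on
the support and the coefficients of the product leave no room for further words in the factors. -/
theorem IsPartialSum.of_mul {i k j : Fin N} {V W : FreeAlgebra ℕ (Entry N)}
    (h : IsPartialSum i k j (V * W)) : IsPartialSum i k j V ∨ IsPartialSum i k j W ∨
      (V = FreeAlgebra.ι ℕ (Entry.a i k) ∧ W = FreeAlgebra.ι ℕ (Entry.b k j)) := by
  obtain ⟨u, v, huv, hu, hv⟩ := exists_of_coef_mul_ne_zero h.ne_zero
  rcases mul_eq_of_mul_of huv with ⟨rfl, rfl⟩ | ⟨rfl, rfl⟩ | ⟨rfl, rfl⟩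
  · refine Or.inr (Or.inl (h.of_le (fun w => ?_) hv))
    have := coef_mul_le V W 1 w
    rw [one_mul] at this
    exact (Nat.le_mul_of_pos_left _ (Nat.pos_of_ne_zero hu)).trans this
  · refine Or.inr (Or.inr ⟨eq_ι_of_coef hu fun w => ?_, eq_ι_of_coef hv fun w => ?_⟩)
    · have h1 := coef_mul_le V W w (FreeMonoid.of (Entry.b k j))
      have h2 := (Nat.le_mul_of_pos_right _ (Nat.pos_of_ne_zero hv)).trans h1
      rw [coef_ι]
      split_ifs with hw
      · exact h2.trans (h.le_one _)
      · by_contra hpos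
        -- A second word w in V would put w · B[k,j] into the product; the shape of the words
        -- allowed there forces w = A[i,k].
        obtain ⟨k', hk'⟩ := h.support (w * FreeMonoid.of (Entry.b k j)) (by omega)
        rcases mul_eq_of_mul_of hk' with ⟨_, h4⟩ | ⟨h3, h4⟩ | ⟨_, h4⟩
        · exact of_mul_of_ne_of _ _ _ h4.symm
        · have := FreeMonoid.of_injective h4
          simp only [Entry.b.injEq, and_true] at this
          exact hw (this ▸ h3)
        · exact FreeMonoid.of_ne_one _ h4
    · have h1 := coef_mul_le V W (FreeMonoid.of (Entry.a i k)) w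
      have h2 := (Nat.le_mul_of_pos_left _ (Nat.pos_of_ne_zero hu)).trans h1
      rw [coef_ι]
      split_ifs with hw
      · exact h2.trans (h.le_one _)
      · by_contra hpos
        obtain ⟨k', hk'⟩ := h.support (FreeMonoid.of (Entry.a i k) * w) (by omega)
        rcases mul_eq_of_mul_of hk' with ⟨h4, _⟩ | ⟨h4, h3⟩ | ⟨h4, _⟩
        · exact FreeMonoid.of_ne_one _ h4
        · have := FreeMonoid.of_injective h4
          simp only [Entry.a.injEq, true_and] at this
          exact hw (this ▸ h3)
        · exact of_mul_of_ne_of _ _ _ h4.symm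
  · refine Or.inl (h.of_le (fun w => ?_) hu)
    have := coef_mul_le V W w 1
    rw [mul_one] at this
    exact (Nat.le_mul_of_pos_right _ (Nat.pos_of_ne_zero hv)).trans this

theorem coef_sum {α X : Type} (s : Finset α) (f : α → FreeAlgebra ℕ X) (w : FreeMonoid X) :
    coef (∑ x ∈ s, f x) w = ∑ x ∈ s, coef (f x) w := by
  classical
  induction s using Finset.induction_on with
  | empty => simp
  | insert a s ha ih => rw [Finset.sum_insert ha, Finset.sum_insert ha, coef_add, ih]

open Classical in
theorem coef_ι_mul_ι {X : Type} (x y : X) (w : FreeMonoid X) :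
    coef (FreeAlgebra.ι ℕ x * FreeAlgebra.ι ℕ y) w
      = if w = FreeMonoid.of x * FreeMonoid.of y then 1 else 0 := by
  simp only [coef, map_mul, FreeAlgebra.equivMonoidAlgebraFreeMonoid, AlgEquiv.ofAlgHom_apply,
    FreeAlgebra.lift_ι_apply, MonoidAlgebra.of_apply, MonoidAlgebra.single_mul_single,
    MonoidAlgebra.coeff_single, Finsupp.single_apply, mul_one]
  exact if_congr eq_comm rfl rfl

theorem isPartialSum_product (i k j : Fin N) :
    IsPartialSum i k j (∑ k', FreeAlgebra.ι ℕ (Entry.a i k') * FreeAlgebra.ι ℕ (Entry.b k' j)) := by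
  classical
  have key : ∀ k', coef (∑ k', FreeAlgebra.ι ℕ (Entry.a i k') * FreeAlgebra.ι ℕ (Entry.b k' j))
      (termWord i k' j) = 1 := by
    intro k'
    rw [coef_sum, Finset.sum_eq_single k']
    · rw [coef_ι_mul_ι]; exact if_pos rfl
    · intro k'' _ hne
      rw [coef_ι_mul_ι]
      exact if_neg fun h => hne (termWord_inj (i := i) (j := j) h).2.1.symm
    · simp
  have supp : ∀ w, coef (∑ k', FreeAlgebra.ι ℕ (Entry.a i k') * FreeAlgebra.ι ℕ (Entry.b k' j)) w
      ≠ 0 → ∃ k', w = termWord i k' j := by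
    intro w hw
    rw [coef_sum] at hw
    obtain ⟨k', _, h⟩ := Finset.exists_ne_zero_of_sum_ne_zero hw
    rw [coef_ι_mul_ι] at h
    exact ⟨k', by by_contra hne; exact h (if_neg hne)⟩
  refine ⟨fun w => ?_, supp, by rw [key]; exact one_ne_zero⟩
  by_contra hw
  obtain ⟨k', rfl⟩ := supp w (by omega)
  exact hw (key k').le

end PartialSums

/-! ### Invariants of the execution of code and messages. -/

section Invariants

variable {γ : Type} [DecidableEq γ] {R : Type} [Semiring R]

theorem execCode_append (m : γ → R) (l l' : List (Instr γ)) :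
    execCode m (l ++ l') = execCode (execCode m l) l' := List.foldl_append

theorem execSteps_append (m : γ → R) (l l' : List (Superstep γ)) :
    execSteps m (l ++ l') = execSteps (execSteps m l) l' := List.foldl_append

theorem execSteps_singleton (m : γ → R) (s : Superstep γ) :
    execSteps m [s] = s.exec m := rfl

/-- The source memory `src` stays fixed during delivery, so the order of the messages and repeated
destinations are harmless. -/
theorem deliver_invariant {S : Type} (p : γ → S → Prop) (src : γ → S) (msgs : List (γ × γ))
    (m : γ → S)
    (hm : ∀ c, p c (m c)) (hmsg : ∀ e ∈ msgs, p e.2 (src e.1)) (c : γ) :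
    p c (msgs.foldl (fun m' e => Function.update m' e.2 (src e.1)) m c) := by
  induction msgs generalizing m with
  | nil => exact hm c
  | cons e l ih =>
    refine ih _ (fun c' => ?_) fun e' he' => hmsg e' (List.mem_cons_of_mem _ he')
    by_cases hc : c' = e.2
    · subst hc
      simpa using hmsg e List.mem_cons_self
    · simpa [Function.update_of_ne hc] using hm c'

/-- The condition of `Program.Valid` on a local instruction. -/
def Instr.IsLocal (home : γ → ℕ) : Instr γ → Prop
  | .zero _ => True
  | .one _ => True
  | .add d x y => home x = home d ∧ home y = home d
  | .mul d x y => home x = home d ∧ home y = home d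

/-- Products get a hypothesis tied to the exact point of the code, since the multiplications are
what has to be recorded as computed terms. The induction therefore removes instructions from the
end. -/
theorem execCode_invariant (home : γ → ℕ) (p : ℕ → R → Prop) (h0 : ∀ r, p r 0) (h1 : ∀ r, p r 1)
    (hadd : ∀ r V W, p r V → p r W → p r (V + W)) (m : γ → R) (hm : ∀ c, p (home c) (m c))
    (code : List (Instr γ)) (hlocal : ∀ I ∈ code, I.IsLocal home)
    (hmul : ∀ pre post d x y, code = pre ++ Instr.mul d x y :: post →
      p (home d) (execCode m pre x) → p (home d) (execCode m pre y) →
      p (home d) (execCode m pre x * execCode m pre y)) (c : γ) :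
    p (home c) (execCode m code c) := by
  induction code using List.reverseRecOn generalizing c with
  | nil => exact hm c
  | append_singleton l I ih =>
    have ih := ih (fun I hI => hlocal I (by simp [hI])) fun pre post d x y h =>
      hmul pre (post ++ [I]) d x y (by simp [h])
    rw [execCode_append]
    have hI := hlocal I (by simp)
    cases I with
    | zero d =>
      by_cases hc : c = d
      · subst hc; simpa [execCode, Instr.exec] using h0 _
      · simpa [execCode, Instr.exec, Function.update_of_ne hc] using ih c
    | one d =>
      by_cases hc : c = d
      · subst hc; simpa [execCode, Instr.exec] using h1 _
      · simpa [execCode, Instr.exec, Function.update_of_ne hc] using ih c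
    | add d x y =>
      by_cases hc : c = d
      · subst hc
        simpa [execCode, Instr.exec] using hadd _ _ _ (hI.1 ▸ ih x) (hI.2 ▸ ih y)
      · simpa [execCode, Instr.exec, Function.update_of_ne hc] using ih c
    | mul d x y =>
      by_cases hc : c = d
      · subst hc
        have := hmul l [] c x y rfl (hI.1 ▸ ih x) (hI.2 ▸ ih y)
        simpa [execCode, Instr.exec] using this
      · simpa [execCode, Instr.exec, Function.update_of_ne hc] using ih c

end Invariants

/-! ### Flow of input entries and partial sums between processing elements. -/

section Flow

variable {N : ℕ} (P : Program N)

theorem Program.Valid.isLocal {P : Program N} {a : ℕ} (h : P.Valid a) {s : Superstep P.Cell}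
    (hs : s ∈ P.steps) (I : Instr P.Cell) (hI : I ∈ s.code) : I.IsLocal P.home := by
  have := h.code_local s hs I hI
  cases I <;> exact this

/-- A property of contents that is preserved by the local operations and by the messages between
different processing elements holds throughout the symbolic execution. -/
theorem Program.Valid.invariant {P : Program N} {a : ℕ} (hP : P.Valid a)
    (p : ℕ → FreeAlgebra ℕ (Entry N) → Prop) (h0 : ∀ r, p r 0) (h1 : ∀ r, p r 1)
    (hadd : ∀ r V W, p r V → p r W → p r (V + W))
    (hinit : ∀ c, p (P.home c) (P.symInit c))
    (hmul : ∀ before s after pre post d x y, P.steps = before ++ s :: after →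
      s.code = pre ++ Instr.mul d x y :: post →
      p (P.home d) (execCode (execSteps P.symInit before) pre x) →
      p (P.home d) (execCode (execSteps P.symInit before) pre y) →
      p (P.home d) (execCode (execSteps P.symInit before) pre x *
        execCode (execSteps P.symInit before) pre y))
    (hmsg : ∀ before s after e, P.steps = before ++ s :: after → e ∈ s.msgs →
      P.home e.1 ≠ P.home e.2 →
      p (P.home e.1) (execCode (execSteps P.symInit before) s.code e.1) →
      p (P.home e.2) (execCode (execSteps P.symInit before) s.code e.1)) :
    ∀ before rest, P.steps = before ++ rest →
      (∀ c, p (P.home c) (execSteps P.symInit before c)) ∧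
      ∀ s after pre post, rest = s :: after → s.code = pre ++ post →
        ∀ c, p (P.home c) (execCode (execSteps P.symInit before) pre c) := by
  have code : ∀ before, (∀ c, p (P.home c) (execSteps P.symInit before c)) →
      ∀ s after pre post, P.steps = before ++ s :: after → s.code = pre ++ post →
        ∀ c, p (P.home c) (execCode (execSteps P.symInit before) pre c) := by
    intro before hm s after pre post hs hc
    refine execCode_invariant P.home p h0 h1 hadd _ hm pre
      (fun I hI => hP.isLocal (s := s) (by simp [hs]) I (by simp [hc, hI])) ?_
    intro pre' post' d x y h
    exact hmul before s after pre' (post' ++ post) d x y hs (by simp [hc, h])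
  intro before
  induction before using List.reverseRecOn with
  | nil =>
    intro rest h
    refine ⟨hinit, fun s after pre post hr hc => ?_⟩
    exact code [] hinit s after pre post (by rw [h, hr]) hc
  | append_singleton l s ih =>
    intro rest h
    have h' : P.steps = l ++ s :: rest := by simpa using h
    have ih := ih _ h'
    have hcode := ih.2 s rest s.code [] rfl (by simp)
    have key : ∀ c, p (P.home c) (execSteps P.symInit (l ++ [s]) c) := by
      intro c
      rw [execSteps_append, execSteps_singleton]
      refine deliver_invariant (fun c V => p (P.home c) V) _ _ _ hcode (fun e he => ?_) c
      by_cases hhome : P.home e.1 = P.home e.2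
      · exact hhome ▸ hcode e.1
      · exact hmsg l s rest e h' he hhome (hcode e.1)
    refine ⟨key, fun s' after pre post hr hc => ?_⟩
    exact code _ key s' after pre post (by rw [h, hr]) hc

/-- The contents of the messages selected by `sel`. -/
noncomputable def msgContents {γ : Type} [DecidableEq γ] {R : Type} [Semiring R]
    (sel : γ × γ → Bool) : (γ → R) → List (Superstep γ) → List R
  | _, [] => []
  | m, s :: l => ((s.msgs.filter sel).map fun e => execCode m s.code e.1) ++
      msgContents sel (s.exec m) l

theorem mem_msgContents {γ : Type} [DecidableEq γ] {R : Type} [Semiring R]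
    {sel : γ × γ → Bool} {m : γ → R} {before after : List (Superstep γ)} {s : Superstep γ}
    {e : γ × γ} (he : e ∈ s.msgs) (hsel : sel e = true) :
    execCode (execSteps m before) s.code e.1 ∈ msgContents sel m (before ++ s :: after) := by
  induction before generalizing m with
  | nil =>
    simp only [List.nil_append, msgContents, List.mem_append, List.mem_map, List.mem_filter]
    exact Or.inl ⟨e, ⟨he, hsel⟩, rfl⟩
  | cons s' l ih =>
    simp only [List.cons_append, msgContents, List.mem_append]
    exact Or.inr (ih (m := s'.exec m))

theorem length_msgContents {γ : Type} [DecidableEq γ] {R : Type} [Semiring R]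
    (sel : γ × γ → Bool) (m : γ → R) (l : List (Superstep γ)) :
    (msgContents sel m l).length = (l.map fun s => s.msgs.countP sel).sum := by
  induction l generalizing m with
  | nil => rfl
  | cons s l ih => simp [msgContents, ih, List.countP_eq_length_filter]

/-- The messages received by `r` from other processing elements. -/
def Program.recvSel (r : ℕ) : P.Cell × P.Cell → Bool :=
  fun e => P.home e.2 = r ∧ P.home e.1 ≠ r

/-- The messages sent by `r` to other processing elements. -/
def Program.sentSel (r : ℕ) : P.Cell × P.Cell → Bool :=
  fun e => P.home e.1 = r ∧ P.home e.2 ≠ r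

/-- The sum of the degrees of all communication supersteps on `2 ^ a` processing elements. -/
def Program.totalDegree (a : ℕ) : ℕ := ∑ i ∈ Finset.range a, P.cumDegree a i

variable {P}

theorem Program.countP_sentSel_le_degree {a r : ℕ} (hr : r < 2 ^ a) (s : Superstep P.Cell) :
    s.msgs.countP (P.sentSel r) ≤ P.degree a s :=
  le_trans (le_max_left _ _) (Finset.le_sup (f := fun r =>
    max (s.msgs.countP fun e => P.home e.1 = r ∧ P.home e.2 ≠ r)
      (s.msgs.countP fun e => P.home e.2 = r ∧ P.home e.1 ≠ r)) (Finset.mem_range.2 hr))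

theorem Program.countP_recvSel_le_degree {a r : ℕ} (hr : r < 2 ^ a) (s : Superstep P.Cell) :
    s.msgs.countP (P.recvSel r) ≤ P.degree a s :=
  le_trans (le_max_right _ _) (Finset.le_sup (f := fun r =>
    max (s.msgs.countP fun e => P.home e.1 = r ∧ P.home e.2 ≠ r)
      (s.msgs.countP fun e => P.home e.2 = r ∧ P.home e.1 ≠ r)) (Finset.mem_range.2 hr))

/-- Supersteps with labels from a on are not charged; they may be left out because their messages
never leave a processing element. -/
theorem sum_map_le_sum_label {γ : Type} (l : List (Superstep γ)) (a : ℕ)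
    (f d : Superstep γ → ℕ) (hfd : ∀ s ∈ l, f s ≤ d s) (h0 : ∀ s ∈ l, a ≤ s.label → f s = 0) :
    (l.map f).sum ≤ ∑ i ∈ Finset.range a, ((l.filter fun s => s.label = i).map d).sum := by
  induction l with
  | nil => simp
  | cons s l ih =>
    have ih := ih (fun s hs => hfd s (List.mem_cons_of_mem _ hs))
      fun s hs => h0 s (List.mem_cons_of_mem _ hs)
    have hs : f s ≤ ∑ i ∈ Finset.range a, if s.label = i then d s else 0 := by
      rw [Finset.sum_ite_eq]
      split_ifs with h
      · exact hfd s List.mem_cons_self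
      · exact (h0 s List.mem_cons_self (by simpa using h)).le
    have : ∑ i ∈ Finset.range a, (((s :: l).filter fun s => s.label = i).map d).sum
        = (∑ i ∈ Finset.range a, if s.label = i then d s else 0)
          + ∑ i ∈ Finset.range a, ((l.filter fun s => s.label = i).map d).sum := by
      rw [← Finset.sum_add_distrib]
      refine Finset.sum_congr rfl fun i _ => ?_
      by_cases h : s.label = i <;> simp [h]
    rw [this, List.map_cons, List.sum_cons]
    exact Nat.add_le_add hs ih

theorem Program.Valid.home_eq_of_label_ge {a : ℕ} (hP : P.Valid a) {s : Superstep P.Cell}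
    (hs : s ∈ P.steps) (hl : a ≤ s.label) {e : P.Cell × P.Cell} (he : e ∈ s.msgs) :
    P.home e.1 = P.home e.2 := by
  have := hP.msgs_cluster s hs e he
  simpa [Nat.sub_eq_zero_of_le hl] using this

theorem Program.Valid.length_sent_le {a r : ℕ} (hP : P.Valid a) (hr : r < 2 ^ a) :
    (msgContents (P.sentSel r) P.symInit P.steps).length ≤ P.totalDegree a := by
  rw [length_msgContents]
  refine sum_map_le_sum_label _ _ _ _ (fun s _ => Program.countP_sentSel_le_degree hr s) ?_
  intro s hs hl
  rw [List.countP_eq_zero]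
  intro e he
  have := hP.home_eq_of_label_ge hs hl he
  simp only [Program.sentSel, decide_eq_true_eq]
  omega

theorem Program.Valid.length_recv_le {a r : ℕ} (hP : P.Valid a) (hr : r < 2 ^ a) :
    (msgContents (P.recvSel r) P.symInit P.steps).length ≤ P.totalDegree a := by
  rw [length_msgContents]
  refine sum_map_le_sum_label _ _ _ _ (fun s _ => Program.countP_recvSel_le_degree hr s) ?_
  intro s hs hl
  rw [List.countP_eq_zero]
  intro e he
  have := hP.home_eq_of_label_ge hs hl he
  simp only [Program.recvSel, decide_eq_true_eq]
  omega

theorem Program.symInit_eq (c : P.Cell) :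
    P.symInit c = 0 ∨ ∃ x, P.init c = some x ∧ P.symInit c = FreeAlgebra.ι ℕ x := by
  simp only [Program.symInit, Program.initMem]
  cases h : P.init c with
  | none => exact Or.inl rfl
  | some x => exact Or.inr ⟨x, rfl, rfl⟩

/-- An input entry that occurs as a content at `r` is there initially or received by `r`. -/
theorem Program.Valid.entry_available {a : ℕ} (hP : P.Valid a) {x : Entry N} {r : ℕ}
    {before after : List (Superstep P.Cell)} {s : Superstep P.Cell} {pre post : List (Instr P.Cell)}
    (hs : P.steps = before ++ s :: after) (hc : s.code = pre ++ post) {c : P.Cell}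
    (hr : P.home c = r)
    (hx : execCode (execSteps P.symInit before) pre c = FreeAlgebra.ι ℕ x) :
    (∃ c, P.home c = r ∧ P.init c = some x) ∨
      FreeAlgebra.ι ℕ x ∈ msgContents (P.recvSel r) P.symInit P.steps := by
  by_contra! hcon
  -- The invariant concerns only the cells at r: without x among the initial contents and the
  -- received messages, no content at r ever equals x.
  have := (hP.invariant (fun r' V => r' = r → V ≠ FreeAlgebra.ι ℕ x)
    (fun _ _ => ι_ne_zero' x) (fun _ _ => ι_ne_one' x)
    (fun r' V W hV hW hr' h => (eq_ι_of_add_eq_ι h).elim (hV hr') (hW hr'))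
    (fun c hcr h => by
      rcases P.symInit_eq c with h0 | ⟨y, hy, h0⟩
      · exact ι_ne_zero' x (h0 ▸ h)
      · rw [h0] at h
        exact hcon.1 c hcr (FreeAlgebra.ι_injective h ▸ hy))
    (fun _ _ _ _ _ _ _ _ _ _ hV hW hr' h => (eq_ι_of_mul_eq_ι h).elim (hV hr') (hW hr'))
    (fun before s after e hs he hne _ hr' h => hcon.2 (by
      rw [← h, hs]
      exact mem_msgContents he (by
        simp only [Program.recvSel, decide_eq_true_eq]
        exact ⟨hr', fun h => hne (h.trans hr'.symm)⟩)))
    before _ hs).2 s after pre post rfl hc c hr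
  exact this hx

theorem Program.Correct.symbolic (hP : P.Correct) (i j : Fin N) :
    execSteps P.symInit P.steps (P.out i j)
      = ∑ k', FreeAlgebra.ι ℕ (Entry.a i k') * FreeAlgebra.ι ℕ (Entry.b k' j) := by
  have h := hP (FreeAlgebra ℕ (Entry N)) (Matrix.of fun i j => FreeAlgebra.ι ℕ (Entry.a i j))
    (Matrix.of fun i j => FreeAlgebra.ι ℕ (Entry.b i j)) i j
  rw [Matrix.mul_apply] at h
  refine Eq.trans ?_ h
  have : entryVal (Matrix.of fun i j => FreeAlgebra.ι ℕ (Entry.a i j))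
      (Matrix.of fun i j => FreeAlgebra.ι ℕ (Entry.b i j))
      = (FreeAlgebra.ι ℕ : Entry N → FreeAlgebra ℕ (Entry N)) := by
    funext x
    cases x <;> rfl
  rw [Program.symInit, this]

/-- Each multiplicative term is computed by some processing element that holds the corresponding
entry of the product at the end or sends a partial sum of it. -/
theorem Program.Valid.exists_termsComputed {a : ℕ} (hP : P.Valid a) (hC : P.Correct)
    (i k j : Fin N) :
    ∃ r, (i, k, j) ∈ P.termsComputed r ∧ (r = P.home (P.out i j) ∨
      ∃ V ∈ msgContents (P.sentSel r) P.symInit P.steps, IsPartialSum i k j V) := by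
  -- A partial sum located at r' was started where its term was multiplied: at r' itself, or at some
  -- r that a partial sum has left by a message. The first crossing of a boundary turns the former
  -- case into the latter.
  have := (hP.invariant (fun r' V => IsPartialSum i k j V → ∃ r, (i, k, j) ∈ P.termsComputed r ∧
      (r = r' ∨ ∃ V ∈ msgContents (P.sentSel r) P.symInit P.steps, IsPartialSum i k j V))
    (fun _ h => (not_isPartialSum_zero _ _ _ h).elim)
    (fun _ h => (not_isPartialSum_one _ _ _ h).elim)
    (fun r' V W hV hW h => h.of_add.elim hV hW)
    (fun c h => by
      rcases P.symInit_eq c with h0 | ⟨y, _, h0⟩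
      · exact (not_isPartialSum_zero _ _ _ (h0 ▸ h)).elim
      · exact (not_isPartialSum_ι _ _ _ _ (h0 ▸ h)).elim)
    (fun before s after pre post d x y hs hc hV hW h => by
      rcases h.of_mul with h | h | ⟨h1, h2⟩
      · exact hV h
      · exact hW h
      · exact ⟨_, ⟨before, after, s, pre, post, d, x, y, hs, hc, rfl, h1, h2⟩, Or.inl rfl⟩)
    (fun before s after e hs he hne hV h => by
      obtain ⟨r, hr, rfl | h'⟩ := hV h
      · refine ⟨_, hr, Or.inr ⟨_, ?_, h⟩⟩
        rw [hs]
        exact mem_msgContents he (by simp [Program.sentSel, Ne.symm hne])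
      · exact ⟨r, hr, Or.inr h'⟩)
    P.steps [] (by simp)).1 (P.out i j)
  exact this (hC.symbolic i j ▸ isPartialSum_product i k j)

end Flow

/-! ### The Loomis-Whitney inequality and the distribution of the work. -/

section Counting

/-- Cauchy-Schwarz over the fibres of (i,k,j) ↦ (i,j): two triples (i,k,j), (i,k',j) in one fibre
are determined by the pair of projections (i,k) and (k',j). -/
theorem card_sq_le_card_projections {α β γ : Type} [DecidableEq α] [DecidableEq β] [DecidableEq γ]
    (T : Finset (α × β × γ)) :
    T.card ^ 2 ≤ (T.image fun τ => (τ.1, τ.2.1)).card * (T.image fun τ => (τ.2.1, τ.2.2)).card *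
      (T.image fun τ => (τ.1, τ.2.2)).card := by
  set C := T.image fun τ => (τ.1, τ.2.2)
  have h1 : T.card = ∑ x ∈ C, (T.filter fun τ => (τ.1, τ.2.2) = x).card :=
    Finset.card_eq_sum_card_fiberwise fun τ hτ => Finset.mem_image_of_mem _ hτ
  have h2 : ∑ x ∈ C, (T.filter fun τ => (τ.1, τ.2.2) = x).card ^ 2 ≤
      (T.image fun τ => (τ.1, τ.2.1)).card * (T.image fun τ => (τ.2.1, τ.2.2)).card := by
    rw [← Finset.card_product]
    simp only [sq, ← Finset.card_product]
    rw [← Finset.card_sigma]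
    refine Finset.card_le_card_of_injOn
      (fun y => ((y.2.1.1, y.2.1.2.1), (y.2.2.2.1, y.2.2.2.2))) ?_ ?_
    · rintro ⟨x, τ, τ'⟩ h
      simp only [Finset.coe_sigma, Finset.coe_product, Set.mem_sigma_iff, Set.mem_prod,
        Finset.mem_coe, Finset.mem_filter] at h
      simp only [Finset.coe_product, Set.mem_prod, Finset.mem_coe]
      exact ⟨Finset.mem_image_of_mem _ h.2.1.1, Finset.mem_image_of_mem _ h.2.2.1⟩
    · rintro ⟨⟨x1, x2⟩, ⟨i, k, j⟩, ⟨i', k', j'⟩⟩ h ⟨⟨y1, y2⟩, ⟨u, v, w⟩, ⟨u', v', w'⟩⟩ h' heq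
      simp only [Finset.coe_sigma, Finset.coe_product, Set.mem_sigma_iff, Set.mem_prod,
        Finset.mem_coe, Finset.mem_filter, Prod.mk.injEq] at h h' heq
      obtain ⟨_, ⟨_, rfl, rfl⟩, _, rfl, rfl⟩ := h
      obtain ⟨_, ⟨_, rfl, rfl⟩, _, rfl, rfl⟩ := h'
      obtain ⟨⟨rfl, rfl⟩, rfl, rfl⟩ := heq
      rfl
  calc T.card ^ 2 ≤ C.card * ∑ x ∈ C, (T.filter fun τ => (τ.1, τ.2.2) = x).card ^ 2 := by
        rw [h1]; exact_mod_cast sq_sum_le_card_mul_sum_sq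
    _ ≤ C.card * _ := Nat.mul_le_mul_left _ h2
    _ = _ := Nat.mul_comm _ _

theorem card_filter_le_length {α β : Type} [Fintype α] (l : List β) (rel : α → β → Prop)
    [DecidablePred fun x => ∃ v ∈ l, rel x v] (inj : ∀ x y v, rel x v → rel y v → x = y) :
    (Finset.univ.filter fun x => ∃ v ∈ l, rel x v).card ≤ l.length := by
  classical
  refine le_trans ?_ l.toFinset_card_le
  refine Finset.card_le_card_of_forall_subsingleton rel (fun x hx => ?_) fun v _ x hx y hy => ?_
  · obtain ⟨v, hv, h⟩ := (Finset.mem_filter.1 hx).2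
    exact ⟨v, List.mem_toFinset.2 hv, h⟩
  · exact inj x y v hx.2 hy.2

theorem sum_card_le_card_univ {α : Type} [Fintype α] (s : Finset ℕ) (f : ℕ → Finset α)
    (h : ∀ r r' x, x ∈ f r → x ∈ f r' → r = r') : ∑ r ∈ s, (f r).card ≤ Fintype.card α := by
  classical
  rw [← Finset.card_biUnion fun r _ r' _ hne =>
    Finset.disjoint_left.2 fun x hx hx' => hne (h r r' x hx hx')]
  exact Finset.card_le_univ _

variable {N : ℕ} {P : Program N}

open Classical in
/-- Every processing element performs a set of multiplicative terms whose number is bounded by the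
numbers of the entries that it holds initially or finally and by the total degree. -/
theorem Program.Valid.exists_work_distribution {a : ℕ} (hP : P.Valid a) (hC : P.Correct)
    (hR : P.NoReplication) :
    ∃ x α β γ : ℕ → ℕ,
      (∀ r < 2 ^ a, x r ^ 2 ≤
        (α r + P.totalDegree a) * (β r + P.totalDegree a) * (γ r + P.totalDegree a)) ∧
      (∀ r < 2 ^ a, x r ≤ (P.termsComputed r).ncard) ∧
      N ^ 3 ≤ ∑ r ∈ Finset.range (2 ^ a), x r ∧
      ∑ r ∈ Finset.range (2 ^ a), α r ≤ N ^ 2 ∧ ∑ r ∈ Finset.range (2 ^ a), β r ≤ N ^ 2 ∧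
      ∑ r ∈ Finset.range (2 ^ a), γ r ≤ N ^ 2 := by
  -- A processing element may compute terms that it never uses, which nothing would charge to an
  -- output entry. Only terms that end up at r or leave r inside a partial sum are counted; they
  -- still cover all N³ terms.
  let T : ℕ → Finset (Fin N × Fin N × Fin N) := fun r => Finset.univ.filter fun τ =>
    τ ∈ P.termsComputed r ∧ (r = P.home (P.out τ.1 τ.2.2) ∨
      ∃ V ∈ msgContents (P.sentSel r) P.symInit P.steps, IsPartialSum τ.1 τ.2.1 τ.2.2 V)
  let A : ℕ → Finset (Fin N × Fin N) := fun r => Finset.univ.filter fun q =>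
    ∃ c, P.home c = r ∧ P.init c = some (Entry.a q.1 q.2)
  let B : ℕ → Finset (Fin N × Fin N) := fun r => Finset.univ.filter fun q =>
    ∃ c, P.home c = r ∧ P.init c = some (Entry.b q.1 q.2)
  let C : ℕ → Finset (Fin N × Fin N) := fun r => Finset.univ.filter fun q =>
    P.home (P.out q.1 q.2) = r
  refine ⟨fun r => (T r).card, fun r => (A r).card, fun r => (B r).card, fun r => (C r).card,
    fun r hr => ?_, fun r _ => ?_, ?_, ?_, ?_, ?_⟩
  · refine (card_sq_le_card_projections (T r)).trans
      (Nat.mul_le_mul (Nat.mul_le_mul ?_ ?_) ?_)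
    · refine le_trans (Finset.card_le_card (t := A r ∪ Finset.univ.filter fun q =>
        ∃ V ∈ msgContents (P.recvSel r) P.symInit P.steps,
          V = FreeAlgebra.ι ℕ (Entry.a q.1 q.2)) ?_) ((Finset.card_union_le _ _).trans
        (Nat.add_le_add_left ((card_filter_le_length _ _ ?_).trans (hP.length_recv_le hr)) _))
      · intro q hq
        obtain ⟨τ, hτ, rfl⟩ := Finset.mem_image.1 hq
        obtain ⟨before, after, s, pre, post, d, x, y, hs, hc, hd, hx, hy⟩ :=
          (Finset.mem_filter.1 hτ).2.1
        have hloc := hP.isLocal (s := s) (by simp [hs]) (.mul d x y) (by simp [hc])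
        rcases hP.entry_available hs hc (hloc.1.trans hd) hx with h | h
        · exact Finset.mem_union_left _ (Finset.mem_filter.2 ⟨Finset.mem_univ _, h⟩)
        · exact Finset.mem_union_right _ (Finset.mem_filter.2 ⟨Finset.mem_univ _, _, h, rfl⟩)
      · rintro ⟨q1, q2⟩ ⟨q1', q2'⟩ V h h'
        have := FreeAlgebra.ι_injective (h.symm.trans h')
        simpa using this
    · refine le_trans (Finset.card_le_card (t := B r ∪ Finset.univ.filter fun q =>
        ∃ V ∈ msgContents (P.recvSel r) P.symInit P.steps,
          V = FreeAlgebra.ι ℕ (Entry.b q.1 q.2)) ?_) ((Finset.card_union_le _ _).trans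
        (Nat.add_le_add_left ((card_filter_le_length _ _ ?_).trans (hP.length_recv_le hr)) _))
      · intro q hq
        obtain ⟨τ, hτ, rfl⟩ := Finset.mem_image.1 hq
        obtain ⟨before, after, s, pre, post, d, x, y, hs, hc, hd, hx, hy⟩ :=
          (Finset.mem_filter.1 hτ).2.1
        have hloc := hP.isLocal (s := s) (by simp [hs]) (.mul d x y) (by simp [hc])
        rcases hP.entry_available hs hc (hloc.2.trans hd) hy with h | h
        · exact Finset.mem_union_left _ (Finset.mem_filter.2 ⟨Finset.mem_univ _, h⟩)
        · exact Finset.mem_union_right _ (Finset.mem_filter.2 ⟨Finset.mem_univ _, _, h, rfl⟩)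
      · rintro ⟨q1, q2⟩ ⟨q1', q2'⟩ V h h'
        have := FreeAlgebra.ι_injective (h.symm.trans h')
        simpa using this
    · refine le_trans (Finset.card_le_card (t := C r ∪ Finset.univ.filter fun q =>
        ∃ V ∈ msgContents (P.sentSel r) P.symInit P.steps,
          ∃ k, IsPartialSum q.1 k q.2 V) ?_) ((Finset.card_union_le _ _).trans
        (Nat.add_le_add_left ((card_filter_le_length _
          (fun (q : Fin N × Fin N) V => ∃ k, IsPartialSum q.1 k q.2 V) ?_).trans (hP.length_sent_le hr)) _))
      · intro q hq
        obtain ⟨τ, hτ, rfl⟩ := Finset.mem_image.1 hq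
        rcases (Finset.mem_filter.1 hτ).2.2 with h | ⟨V, hV, h⟩
        · exact Finset.mem_union_left _ (Finset.mem_filter.2 ⟨Finset.mem_univ _, h.symm⟩)
        · exact Finset.mem_union_right _ (Finset.mem_filter.2 ⟨Finset.mem_univ _, V, hV, _, h⟩)
      · rintro ⟨q1, q2⟩ ⟨q1', q2'⟩ V ⟨_, h⟩ ⟨_, h'⟩
        exact Prod.ext_iff.2 (h.index_unique h')
  · change (T r).card ≤ _
    rw [← Set.ncard_coe_finset]
    exact Set.ncard_le_ncard (fun τ hτ => (Finset.mem_filter.1 hτ).2.1) (Set.toFinite _)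
  · have : (Finset.univ : Finset (Fin N × Fin N × Fin N)) ⊆
        (Finset.range (2 ^ a)).biUnion T := by
      rintro ⟨i, k, j⟩ _
      obtain ⟨r, hr, h⟩ := hP.exists_termsComputed hC i k j
      refine Finset.mem_biUnion.2 ⟨r, Finset.mem_range.2 ?_,
        Finset.mem_filter.2 ⟨Finset.mem_univ _, hr, h⟩⟩
      obtain ⟨_, _, _, _, _, d, _, _, _, _, hd, _⟩ := hr
      exact hd ▸ hP.home_lt d
    have := (Finset.card_le_card this).trans Finset.card_biUnion_le
    simpa [pow_succ, mul_assoc] using this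
  -- Without replication, each input entry is at home at one processing element at most.
  · refine (sum_card_le_card_univ _ A fun r r' q h h' => ?_).trans (by simp [sq])
    obtain ⟨c, rfl, hc⟩ := (Finset.mem_filter.1 h).2
    obtain ⟨c', rfl, hc'⟩ := (Finset.mem_filter.1 h').2
    rw [hR c c' _ hc hc']
  · refine (sum_card_le_card_univ _ B fun r r' q h h' => ?_).trans (by simp [sq])
    obtain ⟨c, rfl, hc⟩ := (Finset.mem_filter.1 h).2
    obtain ⟨c', rfl, hc'⟩ := (Finset.mem_filter.1 h').2
    rw [hR c c' _ hc hc']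
  · refine (sum_card_le_card_univ _ C fun r r' q h h' => ?_).trans (by simp [sq])
    exact (Finset.mem_filter.1 h).2.symm.trans (Finset.mem_filter.1 h').2

end Counting

/-! ### From the work distribution to a lower bound for the total degree. -/

section RealInequality

/-- The case of few processing elements: the load is perfectly balanced. -/
theorem lower_bound_of_balanced {p : ℕ} {N H : ℝ} (hN : 0 < N) (hH : 0 ≤ H) (hp : 2 ≤ p)
    (hp' : p ≤ 1024)
    (x α β γ : ℕ → ℝ) (hα : ∀ r, 0 ≤ α r) (hβ : ∀ r, 0 ≤ β r) (hγ : ∀ r, 0 ≤ γ r)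
    (hx : ∀ r < p, x r ^ 2 ≤ (α r + H) * (β r + H) * (γ r + H))
    (hL : ∀ r < p, x r ≤ N ^ 3 / p) (hsum : N ^ 3 ≤ ∑ r ∈ Finset.range p, x r)
    (hsα : ∑ r ∈ Finset.range p, α r ≤ N ^ 2) (hsβ : ∑ r ∈ Finset.range p, β r ≤ N ^ 2)
    (hsγ : ∑ r ∈ Finset.range p, γ r ≤ N ^ 2) : N ^ 2 / 8100 ≤ H := by
  have hp0 : (0 : ℝ) < p := by positivity
  -- No load exceeds the average and the total is at least N³, so all loads equal the average. A
  -- processing element with few entries at home then still does its full share of the work.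
  have hxr : ∀ r < p, N ^ 3 / p ≤ x r := by
    intro r hr
    by_contra! hlt
    have := Finset.sum_lt_sum (s := Finset.range p) (f := x) (g := fun _ => N ^ 3 / p)
      (fun i hi => hL i (Finset.mem_range.1 hi)) ⟨r, Finset.mem_range.2 hr, hlt⟩
    rw [Finset.sum_const, Finset.card_range, nsmul_eq_mul, mul_div_cancel₀ _ hp0.ne'] at this
    linarith
  obtain ⟨r, hr, hle⟩ : ∃ r ∈ Finset.range p, α r + β r + γ r ≤ 3 * N ^ 2 / p := by
    apply Finset.exists_le_of_sum_le (Finset.nonempty_range_iff.2 (by omega))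
    rw [Finset.sum_add_distrib, Finset.sum_add_distrib, Finset.sum_const, Finset.card_range,
      nsmul_eq_mul, mul_div_cancel₀ _ hp0.ne']
    linarith
  have hr := Finset.mem_range.1 hr
  by_contra! hlt
  have amgm : ∀ x y z : ℝ, 0 ≤ x → 0 ≤ y → 0 ≤ z → x * y * z ≤ ((x + y + z) / 3) ^ 3 := by
    intro x y z hx hy hz
    nlinarith [mul_nonneg hx (sq_nonneg (y - z)), mul_nonneg hy (sq_nonneg (x - z)),
      mul_nonneg hz (sq_nonneg (x - y)), mul_nonneg (add_nonneg (add_nonneg hx hy) hz)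
        (add_nonneg (add_nonneg (sq_nonneg (x - y)) (sq_nonneg (y - z))) (sq_nonneg (x - z)))]
  have h1 : (N ^ 3 / p) ^ 2 ≤ (N ^ 2 / p + H) ^ 3 := by
    have h0 : (0 : ℝ) ≤ N ^ 3 / p := by positivity
    refine (pow_le_pow_left₀ h0 (hxr r hr) 2).trans ((hx r hr).trans ((amgm _ _ _
      (add_nonneg (hα r) hH) (add_nonneg (hβ r) hH) (add_nonneg (hγ r) hH)).trans ?_))
    refine pow_le_pow_left₀ (by linarith [hα r, hβ r, hγ r]) ?_ 3
    have : 3 * N ^ 2 / p = 3 * (N ^ 2 / p) := by ring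
    linarith
  have h2 : (N ^ 2 / p + H) ^ 3 < (N ^ 2 / p + N ^ 2 / 8100) ^ 3 :=
    pow_lt_pow_left₀ (by linarith) (by positivity) (by norm_num)
  have h3 : (N ^ 2 / p + N ^ 2 / 8100) ^ 3 = (N ^ 3 / p) ^ 2 * ((1 + p / 8100) ^ 3 / p) := by
    field_simp
  have hpr : (p : ℝ) ≤ 1024 := by exact_mod_cast hp'
  have hpr2 : (2 : ℝ) ≤ p := by exact_mod_cast hp
  -- Here p ≤ 1024 matters: (1 + 1024/8100)³ is below 2, the smallest possible p.
  have h4 : (1 + (p : ℝ) / 8100) ^ 3 / p ≤ 1 := by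
    rw [div_le_one hp0]
    calc (1 + (p : ℝ) / 8100) ^ 3 ≤ (1 + 1024 / 8100) ^ 3 := by gcongr
      _ ≤ 2 := by norm_num
      _ ≤ p := hpr2
  have h5 : 0 < (N ^ 3 / (p : ℝ)) ^ 2 := by positivity
  nlinarith

/-- The case of many processing elements. -/
theorem lower_bound_of_load_le {p : ℕ} {N H s : ℝ} (hN : 0 < N)
    (hs : 0 ≤ s) (hH : H ≤ s ^ 2) (hH0 : 0 ≤ H) (hsN : s ≤ N / 1440) (hps : p * s ^ 3 ≤ N ^ 3 / 1000)
    (x α β γ : ℕ → ℝ) (hα : ∀ r, 0 ≤ α r) (hβ : ∀ r, 0 ≤ β r) (hγ : ∀ r, 0 ≤ γ r)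
    (hx : ∀ r < p, x r ^ 2 ≤ (α r + H) * (β r + H) * (γ r + H))
    (hL : ∀ r < p, x r ≤ N ^ 3 / 1331)
    (hsα : ∑ r ∈ Finset.range p, α r ≤ N ^ 2) (hsβ : ∑ r ∈ Finset.range p, β r ≤ N ^ 2)
    (hsγ : ∑ r ∈ Finset.range p, γ r ≤ N ^ 2) : ∑ r ∈ Finset.range p, x r < N ^ 3 := by
  -- A bound that is linear in α, β, γ can be summed over r. Elements with at least N²/100 entries
  -- of A are paid for by the load limit. For the others √α ≤ N/10, which makes the main term √(αβγ)
  -- at most (N/20)(β + γ). In total this is (100/1331 + 1/10) N³ plus small terms in s.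
  have key : ∀ r < p, x r ≤ (100 / 1331 * N) * α r + (N / 20) * (β r + γ r)
      + (5 / 2 * s) * (α r + β r + γ r) + 5 / 2 * s ^ 3 := by
    intro r hr
    have hα' := hα r
    have hβ' := hβ r
    have hγ' := hγ r
    rcases le_or_gt (N ^ 2 / 100) (α r) with hrich | hpoor
    · have : N ^ 3 / 1331 ≤ 100 / 1331 * N * α r := by
        have := mul_le_mul_of_nonneg_left hrich hN.le
        nlinarith
      have := hL r hr
      have : 0 ≤ (N / 20) * (β r + γ r) + (5 / 2 * s) * (α r + β r + γ r) + 5 / 2 * s ^ 3 := by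
        positivity
      linarith
    · obtain ⟨u, hu0, hu⟩ : ∃ u, 0 ≤ u ∧ u ^ 2 = α r := ⟨_, Real.sqrt_nonneg _, Real.sq_sqrt hα'⟩
      obtain ⟨v, hv0, hv⟩ : ∃ u, 0 ≤ u ∧ u ^ 2 = β r := ⟨_, Real.sqrt_nonneg _, Real.sq_sqrt hβ'⟩
      obtain ⟨w, hw0, hw⟩ : ∃ u, 0 ≤ u ∧ u ^ 2 = γ r := ⟨_, Real.sqrt_nonneg _, Real.sq_sqrt hγ'⟩
      have huN : u ≤ N / 10 := abs_le_of_sq_le_sq' (by rw [hu]; linarith) (by positivity) |>.2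
      have h1 : x r ≤ (u + s) * (v + s) * (w + s) := by
        refine (abs_le_of_sq_le_sq' ((hx r hr).trans ?_) (by positivity)).2
        rw [mul_pow, mul_pow, ← hu, ← hv, ← hw]
        gcongr <;> nlinarith [mul_nonneg hu0 hs, mul_nonneg hv0 hs, mul_nonneg hw0 hs]
      -- The product (u+s)(v+s)(w+s) is expanded by powers of s; the mixed terms are split into
      -- squares. They contribute 3/2 · s(u² + v² + w²) and, together with s³ itself, 5/2 · s³.
      have h2 : u * (v * w) ≤ N / 10 * ((v ^ 2 + w ^ 2) / 2) :=
        mul_le_mul huN (by nlinarith [sq_nonneg (v - w)]) (by positivity) (by positivity)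
      have h3 : s * (u * v + v * w + w * u) ≤ s * (u ^ 2 + v ^ 2 + w ^ 2) :=
        mul_le_mul_of_nonneg_left
          (by nlinarith [sq_nonneg (u - v), sq_nonneg (v - w), sq_nonneg (w - u)]) hs
      have h4 : s * (s * (u + v + w)) ≤ s * ((3 * s ^ 2 + u ^ 2 + v ^ 2 + w ^ 2) / 2) :=
        mul_le_mul_of_nonneg_left
          (by nlinarith [sq_nonneg (u - s), sq_nonneg (v - s), sq_nonneg (w - s)]) hs
      have h5 : 0 ≤ 100 / 1331 * N * α r := by positivity
      have h6 : 0 ≤ s * (u ^ 2 + v ^ 2 + w ^ 2) := by positivity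
      rw [← hu] at h5
      rw [← hu, ← hv, ← hw]
      nlinarith
  refine (Finset.sum_le_sum fun r hr => key r (Finset.mem_range.1 hr)).trans_lt ?_
  simp only [Finset.sum_add_distrib, ← Finset.mul_sum, Finset.sum_const, Finset.card_range,
    nsmul_eq_mul]
  have h1 := mul_le_mul_of_nonneg_left hsα (by positivity : 0 ≤ 100 / 1331 * N)
  have h2 := mul_le_mul_of_nonneg_left (add_le_add hsβ hsγ) (by positivity : 0 ≤ N / 20)
  have h3 : 5 / 2 * s * (∑ r ∈ Finset.range p, α r + ∑ r ∈ Finset.range p, β r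
      + ∑ r ∈ Finset.range p, γ r) ≤ 5 / 2 * (N / 1440) * (3 * N ^ 2) := by
    have h0 : 0 ≤ ∑ r ∈ Finset.range p, α r + ∑ r ∈ Finset.range p, β r
      + ∑ r ∈ Finset.range p, γ r := add_nonneg (add_nonneg (Finset.sum_nonneg fun r _ => hα r)
        (Finset.sum_nonneg fun r _ => hβ r)) (Finset.sum_nonneg fun r _ => hγ r)
    exact mul_le_mul (by linarith) (by linarith) h0 (by positivity)
  have h4 : 0 < N ^ 3 := by positivity
  nlinarith

/-- For `a = 3 j + 1`, the total degree of an algorithm of the class on `2 ^ a` processing elements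
is at least `n / (8100 * 4 ^ j)`. -/
theorem MMClass.totalDegree_ge {N j : ℕ} {P : Program N} (hN : 0 < N)
    (hP : MMClass (3 * j + 1) P) :
    (N : ℝ) ^ 2 / (8100 * 4 ^ j) ≤ P.totalDegree (3 * j + 1) := by
  obtain ⟨_, _, valid, correct, norep, load, _⟩ := hP
  obtain ⟨x, α, β, γ, hx, hL, hsum, hα, hβ, hγ⟩ := valid.exists_work_distribution correct norep
  have hN' : (0 : ℝ) < N := by exact_mod_cast hN
  set H := P.totalDegree (3 * j + 1)
  have hL' : ∀ r < 2 ^ (3 * j + 1), (x r : ℝ) ≤ (N : ℝ) ^ 3 / min (2 ^ (3 * j + 1)) (11 ^ 3) :=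
    fun r hr => le_trans (by exact_mod_cast hL r hr) (load r hr)
  have hx' : ∀ r < 2 ^ (3 * j + 1), (x r : ℝ) ^ 2 ≤ (α r + H) * (β r + H) * (γ r + H) :=
    fun r hr => by exact_mod_cast hx r hr
  have hsum' : (N : ℝ) ^ 3 ≤ ∑ r ∈ Finset.range (2 ^ (3 * j + 1)), (x r : ℝ) := by
    exact_mod_cast hsum
  have hα' : ∑ r ∈ Finset.range (2 ^ (3 * j + 1)), (α r : ℝ) ≤ (N : ℝ) ^ 2 := by
    exact_mod_cast hα
  have hβ' : ∑ r ∈ Finset.range (2 ^ (3 * j + 1)), (β r : ℝ) ≤ (N : ℝ) ^ 2 := by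
    exact_mod_cast hβ
  have hγ' : ∑ r ∈ Finset.range (2 ^ (3 * j + 1)), (γ r : ℝ) ≤ (N : ℝ) ^ 2 := by
    exact_mod_cast hγ
  rcases le_or_gt j 3 with hj | hj
  -- For j ≤ 3 the machine has fewer than 11³ elements, so condition (ii) enforces perfect balance.
  · have hp : 2 ^ (3 * j + 1) ≤ 1024 := by
      calc 2 ^ (3 * j + 1) ≤ 2 ^ 10 := Nat.pow_le_pow_right (by norm_num) (by omega)
        _ = 1024 := by norm_num
    have hpr : (2 : ℝ) ^ (3 * j + 1) ≤ 1024 := by exact_mod_cast hp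
    have := lower_bound_of_balanced (p := 2 ^ (3 * j + 1)) (H := H) hN' (by positivity)
      (by rw [pow_succ]; have := Nat.one_le_two_pow (n := 3 * j); omega) hp
      (fun r => x r) (fun r => α r) (fun r => β r)
      (fun r => γ r) (fun _ => by positivity) (fun _ => by positivity) (fun _ => by positivity)
      hx' (fun r hr => by
        have := hL' r hr
        rw [min_eq_left (by linarith)] at this
        push_cast
        exact this) hsum' hα' hβ' hγ'
    refine le_trans ?_ this
    have h4 : (1 : ℝ) ≤ 4 ^ j := one_le_pow₀ (by norm_num)
    gcongr
    linarith
  · by_contra! hlt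
    have h16 : (16 : ℝ) ≤ 2 ^ j := by
      calc (16 : ℝ) = 2 ^ 4 := by norm_num
        _ ≤ 2 ^ j := pow_le_pow_right₀ (by norm_num) hj
    have h8 : (2 : ℝ) ^ (3 * j + 1) = 2 * (2 ^ j) ^ 3 := by rw [pow_succ, mul_comm 3 j, pow_mul]; ring
    have h4 : (4 : ℝ) ^ j = (2 ^ j) ^ 2 := by
      rw [← pow_mul, mul_comm j 2, pow_mul]; norm_num
    -- Here s² = N²/(8100 · 4^j) is the claimed bound, 1440 = 90 · 16 comes from j ≥ 4, and p s³ =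
    -- 2N³/90³ does not depend on j.
    have := lower_bound_of_load_le (p := 2 ^ (3 * j + 1)) (H := H) (s := N / (90 * 2 ^ j)) hN'
      (by positivity) (hlt.le.trans (le_of_eq (by rw [h4]; field_simp; norm_num)))
      (by positivity) (by gcongr; linarith)
      (by push_cast; rw [h8]; field_simp; norm_num) (fun r => x r) (fun r => α r) (fun r => β r)
      (fun r => γ r) (fun _ => by positivity) (fun _ => by positivity) (fun _ => by positivity)
      hx' (fun r hr => by
        have h := hL' r hr
        rw [min_eq_right (by
          rw [h8]
          have := pow_le_pow_left₀ (by norm_num) h16 3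
          linarith)] at h
        norm_num at h ⊢
        exact h) hα' hβ' hγ'
    linarith

end RealInequality

/-! ### Degrees under folding. -/

section Folding

variable {N : ℕ} {P : Program N}

theorem countP_le_sum_countP {α ι : Type} (s : Finset ι) (l : List α) (p : α → Bool)
    (q : ι → α → Bool) (h : ∀ e ∈ l, p e → ∃ i ∈ s, q i e) :
    l.countP p ≤ ∑ i ∈ s, l.countP (q i) := by
  induction l with
  | nil => simp
  | cons e l ih =>
    have ih := ih fun e he => h e (List.mem_cons_of_mem _ he)
    simp only [List.countP_cons, Finset.sum_add_distrib]
    refine Nat.add_le_add ih ?_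
    split_ifs with hp
    · obtain ⟨i, hi, hq⟩ := h e List.mem_cons_self hp
      refine le_trans ?_ (Finset.single_le_sum (fun _ _ => Nat.zero_le _) hi)
      simp [hq]
    · exact Nat.zero_le _

/-- A message between different new elements also joins different old ones, and each new element
merges 2^e old ones. -/
theorem Program.degree_fold_le (P : Program N) (b e : ℕ) (s : Superstep P.Cell) :
    (P.fold e).degree b s ≤ 2 ^ e * P.degree (b + e) s := by
  refine Finset.sup_le fun r hr => ?_
  have hr : r < 2 ^ b := Finset.mem_range.1 hr
  have hlt : ∀ r' ∈ Finset.Ico (r * 2 ^ e) (r * 2 ^ e + 2 ^ e), r' < 2 ^ (b + e) := by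
    intro r' hr'
    have h1 := (Finset.mem_Ico.1 hr').2
    have h2 : (r + 1) * 2 ^ e ≤ 2 ^ b * 2 ^ e := Nat.mul_le_mul_right _ hr
    rw [pow_add]
    linarith
  have hmem : ∀ x : ℕ, x / 2 ^ e = r → x ∈ Finset.Ico (r * 2 ^ e) (r * 2 ^ e + 2 ^ e) := by
    rintro x rfl
    rw [Finset.mem_Ico]
    have h1 := Nat.div_add_mod x (2 ^ e)
    have h2 := Nat.mod_lt x (Nat.two_pow_pos e)
    rw [mul_comm] at h1
    constructor <;> omega
  have hcard : ∑ _r' ∈ Finset.Ico (r * 2 ^ e) (r * 2 ^ e + 2 ^ e), P.degree (b + e) s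
      = 2 ^ e * P.degree (b + e) s := by simp
  refine max_le ?_ ?_
  · rw [← hcard]
    refine (countP_le_sum_countP (Finset.Ico (r * 2 ^ e) (r * 2 ^ e + 2 ^ e)) s.msgs _ P.sentSel
      fun x _ hx => ?_).trans (Finset.sum_le_sum fun r' hr' =>
        Program.countP_sentSel_le_degree (hlt r' hr') s)
    replace hx := of_decide_eq_true hx
    refine ⟨_, hmem _ hx.1, ?_⟩
    simp only [Program.sentSel, decide_eq_true_eq, true_and]
    exact fun h => hx.2 ((congrArg (· / 2 ^ e) h).trans hx.1)
  · rw [← hcard]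
    refine (countP_le_sum_countP (Finset.Ico (r * 2 ^ e) (r * 2 ^ e + 2 ^ e)) s.msgs _ P.recvSel
      fun x _ hx => ?_).trans (Finset.sum_le_sum fun r' hr' =>
        Program.countP_recvSel_le_degree (hlt r' hr') s)
    replace hx := of_decide_eq_true hx
    refine ⟨_, hmem _ hx.1, ?_⟩
    simp only [Program.recvSel, decide_eq_true_eq, true_and]
    exact fun h => hx.2 ((congrArg (· / 2 ^ e) h).trans hx.1)

theorem Program.cumDegree_fold_le (P : Program N) (b e i : ℕ) :
    (P.fold e).cumDegree b i ≤ 2 ^ e * P.cumDegree (b + e) i := by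
  unfold Program.cumDegree
  rw [← List.sum_map_mul_left]
  exact List.sum_le_sum fun s _ => P.degree_fold_le b e s

theorem Program.fold_zero (P : Program N) : P.fold 0 = P := by
  simp [Program.fold]

theorem Program.fold_fold (P : Program N) (e e' : ℕ) :
    (P.fold e).fold e' = P.fold (e + e') := by
  simp [Program.fold, Nat.div_div_eq_div_mul, pow_add]

theorem MMClass.fold {a b : ℕ} (hP : MMClass a P) (hb : 1 ≤ b) (hba : b ≤ a) :
    MMClass b (P.fold (a - b)) := by
  rcases hba.eq_or_lt with rfl | hlt
  · rwa [Nat.sub_self, Program.fold_zero]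
  · obtain ⟨_, _, _, _, _, _, hfold⟩ := hP
    exact hfold b hb hlt

/-- The bound for the folding on 2^(3j+1) elements, divided by the folding factor 2^(a-3j-1); the
power left over is 2^(3j+1)/4^j = 2 · 2^j. -/
theorem MMClass.sum_cumDegree_ge {a j : ℕ} (hN : 0 < N) (hP : MMClass a P)
    (hj : 3 * j + 1 ≤ a) :
    (N : ℝ) ^ 2 / (8100 * 2 ^ a) * (2 * 2 ^ j)
      ≤ ∑ i ∈ Finset.range (3 * j + 1), (P.cumDegree a i : ℝ) := by
  have h1 := (hP.fold (by omega) hj).totalDegree_ge hN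
  have h2 : ((P.fold (a - (3 * j + 1))).totalDegree (3 * j + 1) : ℝ)
      ≤ 2 ^ (a - (3 * j + 1)) * ∑ i ∈ Finset.range (3 * j + 1), (P.cumDegree a i : ℝ) := by
    rw [Finset.mul_sum]
    have : (P.fold (a - (3 * j + 1))).totalDegree (3 * j + 1)
        ≤ ∑ i ∈ Finset.range (3 * j + 1), 2 ^ (a - (3 * j + 1)) * P.cumDegree a i := by
      refine Finset.sum_le_sum fun i _ => ?_
      have := P.cumDegree_fold_le (3 * j + 1) (a - (3 * j + 1)) i
      rwa [Nat.add_sub_cancel' hj] at this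
    exact_mod_cast this
  have h3 := h1.trans h2
  obtain ⟨e, rfl⟩ := Nat.exists_eq_add_of_le hj
  rw [Nat.add_sub_cancel_left] at h3
  have h4 : (4 : ℝ) ^ j = (2 ^ j) ^ 2 := by
    rw [← pow_mul, mul_comm j 2, pow_mul]; norm_num
  have h8 : (2 : ℝ) ^ (3 * j + 1 + e) = 2 * (2 ^ j) ^ 3 * 2 ^ e := by
    rw [pow_add, pow_succ, mul_comm 3 j, pow_mul]; ring
  have he : (0 : ℝ) < 2 ^ e := by positivity
  rw [← div_le_iff₀' he] at h3
  refine le_trans (le_of_eq ?_) h3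
  rw [h8, h4]
  field_simp

end Folding

/-! ### Summation by parts against the non-increasing bandwidth parameters. -/

section Weights

/-- Abel summation. The induction carries the last value of g times the partial sum of F - W, which
can only decrease when g is replaced by its next value. -/
theorem sum_mul_antitone_le {a : ℕ} (W F g : ℕ → ℝ)
    (hWF : ∀ b ≤ a, ∑ i ∈ Finset.range b, W i ≤ ∑ i ∈ Finset.range b, F i)
    (hg : ∀ i < a, 0 ≤ g i) (hanti : ∀ i, i + 1 < a → g (i + 1) ≤ g i) :
    ∑ i ∈ Finset.range a, W i * g i ≤ ∑ i ∈ Finset.range a, F i * g i := by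
  have key : ∀ n, n + 1 ≤ a → g n * (∑ i ∈ Finset.range (n + 1), (F i - W i)) ≤
      ∑ i ∈ Finset.range (n + 1), (F i - W i) * g i := by
    intro n
    induction n with
    | zero => intro _; simp [mul_comm]
    | succ n ih =>
      intro hn
      have ih := ih (by omega)
      rw [Finset.sum_range_succ, Finset.sum_range_succ (n := n + 1), mul_add]
      have h1 := hWF (n + 1) (by omega)
      have h2 : 0 ≤ ∑ i ∈ Finset.range (n + 1), (F i - W i) := by
        rw [Finset.sum_sub_distrib]; linarith
      have := mul_le_mul_of_nonneg_right (hanti n hn) h2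
      linarith
  rcases a with _ | n
  · simp
  · have h := key n le_rfl
    have h2 : 0 ≤ ∑ i ∈ Finset.range (n + 1), (F i - W i) := by
      rw [Finset.sum_sub_distrib]; linarith [hWF (n + 1) le_rfl]
    have h3 := mul_nonneg (hg n (by omega)) h2
    simp only [sub_mul, Finset.sum_sub_distrib] at h h3
    linarith

/-- The weight of the supersteps with label `i` in the communication time of the recursive
algorithm. -/
noncomputable def labelWeight (i : ℕ) : ℝ := if 3 ∣ i then 2 ^ (i / 3) else 0

theorem labelWeight_nonneg (i : ℕ) : 0 ≤ labelWeight i := by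
  unfold labelWeight; split_ifs <;> positivity

/-- A geometric sum. The labels 3j+1 and 3j+2 carry no weight, so the lower bound at 3j+1 elements'
bits also serves the next two prefix lengths. -/
theorem sum_labelWeight_le (j m : ℕ) (hm : m ≤ 3 * j + 3) :
    ∑ i ∈ Finset.range m, labelWeight i ≤ 2 * 2 ^ j := by
  have h : ∀ j, ∑ i ∈ Finset.range (3 * j), labelWeight i ≤ 2 ^ j := by
    intro j
    induction j with
    | zero => simp
    | succ j ih =>
      rw [Nat.mul_succ, Finset.sum_range_succ, Finset.sum_range_succ, Finset.sum_range_succ]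
      have h0 : labelWeight (3 * j) = 2 ^ j := by simp [labelWeight]
      have h1 : labelWeight (3 * j + 1) = 0 := if_neg (by omega)
      have h2 : labelWeight (3 * j + 2) = 0 := if_neg (by omega)
      rw [h0, h1, h2, pow_succ]
      linarith
  calc ∑ i ∈ Finset.range m, labelWeight i
      ≤ ∑ i ∈ Finset.range (3 * (j + 1)), labelWeight i :=
        Finset.sum_le_sum_of_subset_of_nonneg (Finset.range_mono (by omega))
          fun i _ _ => labelWeight_nonneg i
    _ ≤ 2 ^ (j + 1) := h _
    _ = 2 * 2 ^ j := by ring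

/-- Lower bound for the communication time of all algorithms of the class. -/
theorem MMClass.commTime_ge {N a : ℕ} {P : Program N} (hN : 0 < N) (hP : MMClass a P)
    (g ℓ : Fin a → ℝ) (hg : ∀ i, 0 < g i) (hℓ : ∀ i, 0 ≤ ℓ i) (hanti : Antitone g) :
    (N : ℝ) ^ 2 / (8100 * 2 ^ a) * ∑ i : Fin a, labelWeight i * g i ≤ P.commTime a g ℓ := by
  let G : ℕ → ℝ := fun i => if h : i < a then g ⟨i, h⟩ else 0
  have hG : ∀ i : Fin a, G i = g i := fun i => by simp [G]
  set w : ℝ := (N : ℝ) ^ 2 / (8100 * 2 ^ a)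
  have hw : 0 ≤ w := by positivity
  have h1 : w * ∑ i : Fin a, labelWeight i * g i
      = ∑ i ∈ Finset.range a, (w * labelWeight i) * G i := by
    rw [← Fin.sum_univ_eq_sum_range (fun i => (w * labelWeight i) * G i), Finset.mul_sum]
    exact Finset.sum_congr rfl fun i _ => by rw [hG]; ring
  -- The latency terms are non-negative and are dropped.
  have h2 : ∑ i ∈ Finset.range a, (P.cumDegree a i : ℝ) * G i ≤ P.commTime a g ℓ := by
    rw [← Fin.sum_univ_eq_sum_range (fun i => (P.cumDegree a i : ℝ) * G i)]
    refine Finset.sum_le_sum fun i _ => ?_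
    rw [hG]
    have := mul_nonneg (Nat.cast_nonneg (α := ℝ) (P.numSteps i)) (hℓ i)
    linarith
  rw [h1]
  refine le_trans (sum_mul_antitone_le _ _ G (fun b hb => ?_) (fun i hi => ?_) fun i hi => ?_) h2
  · rw [← Finset.mul_sum]
    rcases Nat.eq_zero_or_pos b with rfl | hb0
    · simp
    · obtain ⟨j, hj1, hj2⟩ : ∃ j, 3 * j + 1 ≤ b ∧ b ≤ 3 * j + 3 :=
        ⟨(b - 1) / 3, by omega, by omega⟩
      calc w * ∑ i ∈ Finset.range b, labelWeight i ≤ w * (2 * 2 ^ j) :=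
            mul_le_mul_of_nonneg_left (sum_labelWeight_le j b hj2) hw
        _ ≤ ∑ i ∈ Finset.range (3 * j + 1), (P.cumDegree a i : ℝ) :=
            hP.sum_cumDegree_ge hN (hj1.trans hb)
        _ ≤ ∑ i ∈ Finset.range b, (P.cumDegree a i : ℝ) :=
            Finset.sum_le_sum_of_subset_of_nonneg (Finset.range_mono hj1)
              fun _ _ _ => Nat.cast_nonneg _
  · simp only [G, hi, dif_pos]
    exact (hg _).le
  · simp only [G, hi, dif_pos, (Nat.lt_succ_self i).trans hi]
    exact hanti (Fin.mk_le_mk.2 (Nat.le_succ i))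

end Weights

/-! ### Final contents after messages and after blocks of code. -/

section Deliver

variable {γ : Type} [DecidableEq γ] {S : Type}

/-- The last message to y wins, so it suffices that all messages to y agree. -/
theorem deliver_eq (src : γ → S) (msgs : List (γ × γ)) (m : γ → S) (y : γ) (v : S)
    (h : ∀ e ∈ msgs, e.2 = y → src e.1 = v) (hex : ∃ e ∈ msgs, e.2 = y) :
    msgs.foldl (fun m' e => Function.update m' e.2 (src e.1)) m y = v := by
  induction msgs using List.reverseRecOn with
  | nil => simp at hex
  | append_singleton l e ih =>
    rw [List.foldl_append, List.foldl_cons, List.foldl_nil]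
    by_cases hy : e.2 = y
    · rw [← h e (by simp) hy, ← hy, Function.update_self]
    · rw [Function.update_of_ne (Ne.symm hy)]
      refine ih (fun e' he' => h e' (by simp [he'])) ?_
      obtain ⟨e', he', hy'⟩ := hex
      rcases List.mem_append.1 he' with he' | he'
      · exact ⟨e', he', hy'⟩
      · rw [List.mem_singleton.1 he'] at hy'
        exact (hy hy').elim

variable {R : Type} [Semiring R]

/-- The destination of an instruction. -/
def Instr.dest : Instr γ → γ
  | .zero d => d
  | .one d => d
  | .add d _ _ => d
  | .mul d _ _ => d

theorem execCode_of_ne_dest (m : γ → R) (code : List (Instr γ)) (y : γ)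
    (h : ∀ I ∈ code, I.dest ≠ y) : execCode m code y = m y := by
  induction code generalizing m with
  | nil => rfl
  | cons I l ih =>
    refine (ih (Instr.exec m I) fun I hI => h I (List.mem_cons_of_mem _ hI)).trans ?_
    have := (h I List.mem_cons_self).symm
    cases I <;> exact Function.update_of_ne this _ _

/-- For loops whose passes keep the operands intact (`good`) and do not destroy each other's results
(`post`). -/
theorem execCode_flatMap {α : Type} (l : List α) (f : α → List (Instr γ))
    (good : (γ → R) → Prop) (post : α → (γ → R) → Prop)
    (hgood : ∀ x ∈ l, ∀ m, good m → good (execCode m (f x)))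
    (hpost : ∀ x ∈ l, ∀ m, good m → post x (execCode m (f x)))
    (hkeep : ∀ x ∈ l, ∀ y ∈ l, ∀ m, good m → post x m → post x (execCode m (f y)))
    (m : γ → R) (hm : good m) :
    good (execCode m (l.flatMap f)) ∧ ∀ x ∈ l, post x (execCode m (l.flatMap f)) := by
  induction l using List.reverseRecOn with
  | nil => exact ⟨hm, by simp⟩
  | append_singleton l a ih =>
    obtain ⟨h1, h2⟩ := ih (fun x hx => hgood x (by simp [hx])) (fun x hx => hpost x (by simp [hx]))
      fun x hx y hy => hkeep x (by simp [hx]) y (by simp [hy])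
    have heq : (l ++ [a]).flatMap f = l.flatMap f ++ f a := by simp
    rw [heq, execCode_append]
    refine ⟨hgood a (by simp) _ h1, fun x hx => ?_⟩
    rcases List.mem_append.1 hx with hx' | hx'
    · exact hkeep x hx a (by simp) _ h1 (h2 x hx')
    · rw [List.mem_singleton.1 hx']
      exact hpost a (by simp) _ h1

end Deliver

/-! ### Correctness of the recursive algorithm. -/

section MatrixProgram

theorem radix_inj {x y u v M : ℕ} (hu : u < M) (hv : v < M) (h : x * M + u = y * M + v) :
    x = y ∧ u = v := by
  have h1 := congrArg (· % M) h
  simp only [Nat.mul_add_mod', Nat.mod_eq_of_lt hu, Nat.mod_eq_of_lt hv] at h1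
  subst h1
  exact ⟨Nat.eq_of_mul_eq_mul_right (by omega) (Nat.add_right_cancel h), rfl⟩

theorem mmDepth_bounds (k : ℕ) : 2 * k ≤ 3 * mmDepth k ∧ 3 * mmDepth k ≤ 2 * k + 2 := by
  unfold mmDepth; omega

theorem lt_of_lt_mmDepth {k i : ℕ} (hi : i < mmDepth k) : i < k ∧ 3 * i < 2 * k := by
  have := mmDepth_bounds k; omega

theorem mmDepth_le (k : ℕ) : mmDepth k ≤ k := by
  rcases Nat.eq_zero_or_pos (mmDepth k) with h | h
  · omega
  · have := (lt_of_lt_mmDepth (k := k) (i := mmDepth k - 1) (by omega)).1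
    omega

theorem two_pow_sub {k i : ℕ} (hi : i < k) : 2 ^ (k - i) = 2 * 2 ^ (k - (i + 1)) := by
  rw [← pow_succ']
  congr 1
  omega

theorem mem_mmForAll {α : Type} {k i : ℕ} {f : ℕ → ℕ → ℕ → ℕ → ℕ → ℕ → List α} {e : α} :
    e ∈ mmForAll k i f ↔ ∃ t < 8 ^ i, ∃ h < 2, ∃ k' < 2, ∃ l < 2, ∃ r < 2 ^ (k - (i + 1)),
      ∃ c < 2 ^ (k - (i + 1)), e ∈ f t h k' l r c := by
  simp only [mmForAll, List.mem_flatMap, List.mem_range]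

theorem mem_mmDummy {k i : ℕ} {e : MMCell × MMCell} (he : e ∈ mmDummy k i) :
    ∃ j < 4 ^ k / 2 ^ (3 * i + 1), e = (.dummy j, .dummy (j + 4 ^ k / 2 ^ (3 * i + 1))) := by
  simp only [mmDummy, List.mem_flatMap, List.mem_range] at he
  obtain ⟨j, hj, he⟩ := he
  exact ⟨j, hj, List.eq_of_mem_replicate he⟩

theorem mem_mmDown {k i : ℕ} {e : MMCell × MMCell} (he : e ∈ (mmDown k i).msgs) :
    (∃ t < 8 ^ i, ∃ h < 2, ∃ k' < 2, ∃ l < 2, ∃ r < 2 ^ (k - (i + 1)), ∃ c < 2 ^ (k - (i + 1)),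
      e = (.a i t (h * 2 ^ (k - (i + 1)) + r) (l * 2 ^ (k - (i + 1)) + c),
          .a (i + 1) (8 * t + (4 * h + 2 * k' + l)) r c) ∨
      e = (.b i t (l * 2 ^ (k - (i + 1)) + r) (k' * 2 ^ (k - (i + 1)) + c),
          .b (i + 1) (8 * t + (4 * h + 2 * k' + l)) r c)) ∨
    ∃ j < 4 ^ k / 2 ^ (3 * i + 1), e = (.dummy j, .dummy (j + 4 ^ k / 2 ^ (3 * i + 1))) := by
  rcases List.mem_append.1 he with he | he
  · left
    simpa only [mem_mmForAll, List.mem_cons, List.not_mem_nil, or_false] using he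
  · exact Or.inr (mem_mmDummy he)

theorem mem_mmUp {k i : ℕ} {e : MMCell × MMCell} (he : e ∈ (mmUp k i).msgs) :
    (∃ t < 8 ^ i, ∃ h < 2, ∃ k' < 2, ∃ l < 2, ∃ r < 2 ^ (k - (i + 1)), ∃ c < 2 ^ (k - (i + 1)),
      e = (.m (i + 1) (8 * t + (4 * h + 2 * k' + l)) r c,
          .part i t l (h * 2 ^ (k - (i + 1)) + r) (k' * 2 ^ (k - (i + 1)) + c))) ∨
    ∃ j < 4 ^ k / 2 ^ (3 * i + 1), e = (.dummy j, .dummy (j + 4 ^ k / 2 ^ (3 * i + 1))) := by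
  rcases List.mem_append.1 he with he | he
  · left
    simpa only [mem_mmForAll, List.mem_cons, List.not_mem_nil, or_false] using he
  · exact Or.inr (mem_mmDummy he)

variable {R : Type} [Semiring R]

/-- The left factors of the subproblems of level `i`, for the matrix `f`. -/
def leftFactor (k : ℕ) (f : ℕ → ℕ → R) : ℕ → ℕ → ℕ → ℕ → R
  | 0, _, r, c => f r c
  | i + 1, t, r, c => leftFactor k f i (t / 8) (t / 4 % 2 * 2 ^ (k - (i + 1)) + r)
      (t % 2 * 2 ^ (k - (i + 1)) + c)

/-- The right factors of the subproblems of level `i`, for the matrix `f`. -/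
def rightFactor (k : ℕ) (f : ℕ → ℕ → R) : ℕ → ℕ → ℕ → ℕ → R
  | 0, _, r, c => f r c
  | i + 1, t, r, c => rightFactor k f i (t / 8) (t % 2 * 2 ^ (k - (i + 1)) + r)
      (t / 2 % 2 * 2 ^ (k - (i + 1)) + c)

/-- The products of the subproblems of level `i`. -/
def subproduct (k : ℕ) (f g : ℕ → ℕ → R) (i t r c : ℕ) : R :=
  ∑ s ∈ Finset.range (2 ^ (k - i)), leftFactor k f i t r s * rightFactor k g i t s c

theorem sum_range_two_mul {M : ℕ} (F : ℕ → R) :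
    ∑ s ∈ Finset.range (2 * M), F s
      = ∑ s ∈ Finset.range M, F (0 * M + s) + ∑ s ∈ Finset.range M, F (1 * M + s) := by
  rw [two_mul, Finset.sum_range_add]
  simp

/-- Block multiplication: the inner summation index is cut into its halves l = 0 and l = 1, and h,
k', l are read off as the binary digits of the number of the subproblem. -/
theorem subproduct_split {k i : ℕ} (hi : i < k) (f g : ℕ → ℕ → R) (t : ℕ) {h k' : ℕ} (r c : ℕ)
    (hh : h < 2) (hk : k' < 2) :
    subproduct k f g i t (h * 2 ^ (k - (i + 1)) + r) (k' * 2 ^ (k - (i + 1)) + c)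
      = subproduct k f g (i + 1) (8 * t + (4 * h + 2 * k' + 0)) r c
        + subproduct k f g (i + 1) (8 * t + (4 * h + 2 * k' + 1)) r c := by
  have aux : ∀ l < 2, subproduct k f g (i + 1) (8 * t + (4 * h + 2 * k' + l)) r c
      = ∑ s ∈ Finset.range (2 ^ (k - (i + 1))),
        leftFactor k f i t (h * 2 ^ (k - (i + 1)) + r) (l * 2 ^ (k - (i + 1)) + s) *
        rightFactor k g i t (l * 2 ^ (k - (i + 1)) + s) (k' * 2 ^ (k - (i + 1)) + c) := by
    intro l hl
    refine Finset.sum_congr rfl fun s _ => ?_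
    simp only [leftFactor, rightFactor]
    rw [show (8 * t + (4 * h + 2 * k' + l)) / 8 = t by omega,
      show (8 * t + (4 * h + 2 * k' + l)) / 4 % 2 = h by omega,
      show (8 * t + (4 * h + 2 * k' + l)) % 2 = l by omega,
      show (8 * t + (4 * h + 2 * k' + l)) / 2 % 2 = k' by omega]
  rw [aux 0 (by omega), aux 1 (by omega), subproduct, two_pow_sub hi, sum_range_two_mul]

/-- After the distribution on the levels below `i`, the factors of level `i` are in place. -/
def FactorsReady (k : ℕ) (f g : ℕ → ℕ → R) (i : ℕ) (m : MMCell → R) : Prop :=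
  ∀ t < 8 ^ i, ∀ r < 2 ^ (k - i), ∀ c < 2 ^ (k - i),
    m (.a i t r c) = leftFactor k f i t r c ∧ m (.b i t r c) = rightFactor k g i t r c

theorem FactorsReady.down {k i : ℕ} {f g : ℕ → ℕ → R} {m : MMCell → R} (hi : i < k)
    (hm : FactorsReady k f g i m) : FactorsReady k f g (i + 1) ((mmDown k i).exec m) := by
  intro t ht r hr c hc
  have h2 := two_pow_sub hi
  have h8 : t / 8 < 8 ^ i := by rw [pow_succ] at ht; omega
  have hq : ∀ {h x M : ℕ}, h < 2 → x < M → h * M + x < 2 * M := by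
    intro h x M hh hx
    have : h * M ≤ 1 * M := Nat.mul_le_mul_right _ (by omega)
    omega
  have hdec : t = 8 * (t / 8) + (4 * (t / 4 % 2) + 2 * (t / 2 % 2) + t % 2) := by omega
  constructor
  · refine deliver_eq _ _ _ _ _ (fun e he hy => ?_) ?_
    · rcases mem_mmDown he with
        ⟨t', ht', h, hh, k', hk', l, hl, r', hr', c', hc', rfl | rfl⟩ | ⟨j, hj, rfl⟩
      · simp only [MMCell.a.injEq, true_and] at hy
        obtain ⟨rfl, rfl, rfl⟩ := hy
        simp only [leftFactor]
        rw [show (8 * t' + (4 * h + 2 * k' + l)) / 8 = t' by omega,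
          show (8 * t' + (4 * h + 2 * k' + l)) / 4 % 2 = h by omega,
          show (8 * t' + (4 * h + 2 * k' + l)) % 2 = l by omega]
        exact (hm t' ht' _ (h2 ▸ hq hh hr) _ (h2 ▸ hq hl hc)).1
      · simp at hy
      · simp at hy
    · refine ⟨_, List.mem_append_left _ (mem_mmForAll.2 ⟨t / 8, h8, t / 4 % 2, by omega,
        t / 2 % 2, by omega, t % 2, by omega, r, hr, c, hc, List.mem_cons_self⟩), ?_⟩
      rw [← hdec]
  · refine deliver_eq _ _ _ _ _ (fun e he hy => ?_) ?_
    · rcases mem_mmDown he with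
        ⟨t', ht', h, hh, k', hk', l, hl, r', hr', c', hc', rfl | rfl⟩ | ⟨j, hj, rfl⟩
      · simp at hy
      · simp only [MMCell.b.injEq, true_and] at hy
        obtain ⟨rfl, rfl, rfl⟩ := hy
        simp only [rightFactor]
        rw [show (8 * t' + (4 * h + 2 * k' + l)) / 8 = t' by omega,
          show (8 * t' + (4 * h + 2 * k' + l)) / 2 % 2 = k' by omega,
          show (8 * t' + (4 * h + 2 * k' + l)) % 2 = l by omega]
        exact (hm t' ht' _ (h2 ▸ hq hl hr) _ (h2 ▸ hq hk' hc)).2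
      · simp at hy
    · refine ⟨_, List.mem_append_left _ (mem_mmForAll.2 ⟨t / 8, h8, t / 4 % 2, by omega,
        t / 2 % 2, by omega, t % 2, by omega, r, hr, c, hc,
        List.mem_cons_of_mem _ List.mem_cons_self⟩), ?_⟩
      rw [← hdec]

theorem FactorsReady.downs {k n : ℕ} {f g : ℕ → ℕ → R} {m : MMCell → R} (hn : n ≤ k)
    (hm : FactorsReady k f g 0 m) :
    FactorsReady k f g n (execSteps m ((List.range n).map (mmDown k))) := by
  induction n with
  | zero => exact hm
  | succ n ih =>
    rw [List.range_succ, List.map_append, execSteps_append]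
    exact (ih (by omega)).down (by omega)

/-- The operands of the local code that completes the products of level `i` are in place. -/
def OperandsReady (k : ℕ) (f g : ℕ → ℕ → R) (i : ℕ) (m : MMCell → R) : Prop :=
  if i = mmDepth k then FactorsReady k f g i m else
    ∀ t < 8 ^ i, ∀ h < 2, ∀ k' < 2, ∀ l < 2, ∀ r < 2 ^ (k - (i + 1)), ∀ c < 2 ^ (k - (i + 1)),
      m (.part i t l (h * 2 ^ (k - (i + 1)) + r) (k' * 2 ^ (k - (i + 1)) + c))
        = subproduct k f g (i + 1) (8 * t + (4 * h + 2 * k' + l)) r c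

/-- The part of `mmCode` for one entry. -/
def mmBlock (k i t r c : ℕ) : List (Instr MMCell) :=
  if i = mmDepth k then
    .zero (.m i t r c) :: (List.range (2 ^ (k - i))).flatMap fun s =>
      [.mul (.tmp i t r c) (.a i t r s) (.b i t s c),
        .add (.m i t r c) (.m i t r c) (.tmp i t r c)]
  else [.add (.m i t r c) (.part i t 0 r c) (.part i t 1 r c)]

theorem mem_range_product {a b c : ℕ} {τ : ℕ × ℕ × ℕ} :
    τ ∈ List.range a ×ˢ (List.range b ×ˢ List.range c) ↔ τ.1 < a ∧ τ.2.1 < b ∧ τ.2.2 < c := by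
  obtain ⟨t, r, c⟩ := τ
  change _ ∈ List.product _ (List.product _ _) ↔ _
  rw [List.pair_mem_product, List.pair_mem_product, List.mem_range, List.mem_range, List.mem_range]

theorem mmCode_eq (k i : ℕ) : mmCode k i =
    (List.range (8 ^ i) ×ˢ (List.range (2 ^ (k - i)) ×ˢ List.range (2 ^ (k - i)))).flatMap
      fun τ => mmBlock k i τ.1 τ.2.1 τ.2.2 := by
  simp only [mmCode, SProd.sprod, List.product, List.flatMap_assoc, List.flatMap_map]
  rfl

theorem mem_mmCode {k i : ℕ} {I : Instr MMCell} : I ∈ mmCode k i ↔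
    ∃ t < 8 ^ i, ∃ r < 2 ^ (k - i), ∃ c < 2 ^ (k - i), I ∈ mmBlock k i t r c := by
  simp only [mmCode, List.mem_flatMap, List.mem_range]
  rfl

theorem dest_of_mem_mmBlock {k i t r c : ℕ} {I : Instr MMCell} (hI : I ∈ mmBlock k i t r c) :
    I.dest = .m i t r c ∨ I.dest = .tmp i t r c := by
  unfold mmBlock at hI
  split_ifs at hI
  · simp only [List.mem_cons, List.mem_flatMap, List.not_mem_nil, or_false] at hI
    rcases hI with rfl | ⟨s, _, rfl | rfl⟩
    · exact Or.inl rfl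
    · exact Or.inr rfl
    · exact Or.inl rfl
  · rw [List.mem_singleton.1 hI]
    exact Or.inl rfl

theorem execCode_mulLoop (m : MMCell → R) (i t r c n : ℕ) :
    execCode m (.zero (.m i t r c) :: (List.range n).flatMap fun s =>
      [.mul (.tmp i t r c) (.a i t r s) (.b i t s c),
        .add (.m i t r c) (.m i t r c) (.tmp i t r c)]) (.m i t r c)
      = ∑ s ∈ Finset.range n, m (.a i t r s) * m (.b i t s c) := by
  induction n with
  | zero => simp [execCode, Instr.exec]
  | succ n ih =>
    have hne : ∀ y, y ≠ .m i t r c → y ≠ .tmp i t r c →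
        execCode m (.zero (.m i t r c) :: (List.range n).flatMap fun s =>
          [.mul (.tmp i t r c) (.a i t r s) (.b i t s c),
            .add (.m i t r c) (.m i t r c) (.tmp i t r c)]) y = m y := by
      intro y h1 h2
      refine execCode_of_ne_dest _ _ _ fun I hI => ?_
      simp only [List.mem_cons, List.mem_flatMap, List.not_mem_nil, or_false] at hI
      rcases hI with rfl | ⟨s, _, rfl | rfl⟩
      · exact h1.symm
      · exact h2.symm
      · exact h1.symm
    rw [List.range_succ, List.flatMap_append, ← List.cons_append, execCode_append,
      Finset.sum_range_succ, ← ih, ← hne (.a i t r n) (by simp) (by simp),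
      ← hne (.b i t n c) (by simp) (by simp)]
    generalize execCode m _ = m'
    simp [execCode, Instr.exec]

/-- The code writes only `m` and `tmp` cells, whereas the operands are in `a`, `b` or `part` cells;
blocks for different positions have different `m` cells. -/
theorem OperandsReady.code {k i : ℕ} {f g : ℕ → ℕ → R} {m : MMCell → R} (hi : i ≤ mmDepth k)
    (hm : OperandsReady k f g i m) {t r c : ℕ} (ht : t < 8 ^ i) (hr : r < 2 ^ (k - i))
    (hc : c < 2 ^ (k - i)) :
    execCode m (mmCode k i) (.m i t r c) = subproduct k f g i t r c := by
  have hblock : ∀ t r c y, y ≠ .m i t r c → y ≠ .tmp i t r c → ∀ m' : MMCell → R,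
      execCode m' (mmBlock k i t r c) y = m' y := by
    intro t r c y h1 h2 m'
    refine execCode_of_ne_dest _ _ _ fun I hI => ?_
    rcases dest_of_mem_mmBlock hI with h | h
    · exact h ▸ h1.symm
    · exact h ▸ h2.symm
  have hgood : ∀ t r c, ∀ m' : MMCell → R, OperandsReady k f g i m' →
      OperandsReady k f g i (execCode m' (mmBlock k i t r c)) := by
    intro t r c m' h'
    unfold OperandsReady at h' ⊢
    split_ifs at h' ⊢ with h
    · intro t' ht' r' hr' c' hc'
      rw [hblock _ _ _ _ (by simp) (by simp), hblock _ _ _ _ (by simp) (by simp)]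
      exact h' t' ht' r' hr' c' hc'
    · intro t' ht' h hh k' hk' l hl r' hr' c' hc'
      rw [hblock _ _ _ _ (by simp) (by simp)]
      exact h' t' ht' h hh k' hk' l hl r' hr' c' hc'
  have hpost : ∀ t < 8 ^ i, ∀ r < 2 ^ (k - i), ∀ c < 2 ^ (k - i), ∀ m' : MMCell → R,
      OperandsReady k f g i m' →
      execCode m' (mmBlock k i t r c) (.m i t r c) = subproduct k f g i t r c := by
    intro t ht r hr c hc m' h'
    unfold OperandsReady at h'
    unfold mmBlock
    split_ifs at h' ⊢ with h
    · rw [execCode_mulLoop]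
      exact Finset.sum_congr rfl fun s hs => by
        rw [(h' t ht r hr s (Finset.mem_range.1 hs)).1, (h' t ht s (Finset.mem_range.1 hs) c hc).2]
    · have hik := (lt_of_lt_mmDepth (lt_of_le_of_ne hi h)).1
      have hM : 0 < 2 ^ (k - (i + 1)) := Nat.two_pow_pos _
      rw [two_pow_sub hik] at hr hc
      have hr' : r / 2 ^ (k - (i + 1)) < 2 := Nat.div_lt_of_lt_mul (by linarith)
      have hc' : c / 2 ^ (k - (i + 1)) < 2 := Nat.div_lt_of_lt_mul (by linarith)
      have h0 := h' t ht _ hr' _ hc' 0 (by omega) _ (Nat.mod_lt r hM) _ (Nat.mod_lt c hM)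
      have h1 := h' t ht _ hr' _ hc' 1 (by omega) _ (Nat.mod_lt r hM) _ (Nat.mod_lt c hM)
      have hs := subproduct_split hik f g t (r % 2 ^ (k - (i + 1))) (c % 2 ^ (k - (i + 1))) hr' hc'
      rw [← h0, ← h1, Nat.div_add_mod', Nat.div_add_mod'] at hs
      rw [hs]
      simp [execCode, Instr.exec]
  rw [mmCode_eq]
  have := (execCode_flatMap
    (List.range (8 ^ i) ×ˢ (List.range (2 ^ (k - i)) ×ˢ List.range (2 ^ (k - i)))) (fun τ : ℕ × ℕ × ℕ => mmBlock k i τ.1 τ.2.1 τ.2.2)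
    (OperandsReady k f g i)
    (fun τ m' => m' (.m i τ.1 τ.2.1 τ.2.2) = subproduct k f g i τ.1 τ.2.1 τ.2.2)
    (fun τ _ m' h' => hgood _ _ _ m' h')
    (fun τ hτ m' h' => by
      have hτ := mem_range_product.1 hτ
      exact hpost _ hτ.1 _ hτ.2.1 _ hτ.2.2 m' h')
    (fun τ hτ τ' _ m' h' h'' => by
      by_cases heq : τ = τ'
      · subst heq
        have hτ := mem_range_product.1 hτ
        exact hpost _ hτ.1 _ hτ.2.1 _ hτ.2.2 m' h'
      · rw [hblock _ _ _ _ ?_ (by simp)]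
        · exact h''
        · intro h
          simp only [MMCell.m.injEq, true_and] at h
          exact heq (Prod.ext h.1 (Prod.ext h.2.1 h.2.2)))
    m hm).2 (t, r, c)
  exact this (mem_range_product.2 ⟨ht, hr, hc⟩)

theorem OperandsReady.up {k i : ℕ} {f g : ℕ → ℕ → R} {m : MMCell → R} (hi : i < mmDepth k)
    (hm : OperandsReady k f g (i + 1) m) : OperandsReady k f g i ((mmUp k i).exec m) := by
  rw [OperandsReady, if_neg hi.ne]
  intro t ht h hh k' hk' l hl r hr c hc
  refine deliver_eq _ _ _ _ _ (fun e he hy => ?_) ?_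
  · rcases mem_mmUp he with
      ⟨t', ht', h', hh', k'', hk'', l', hl', r', hr', c', hc', rfl⟩ | ⟨j, hj, rfl⟩
    · simp only [MMCell.part.injEq, true_and] at hy
      obtain ⟨rfl, rfl, h1, h2⟩ := hy
      obtain ⟨rfl, rfl⟩ := radix_inj hr' hr h1
      obtain ⟨rfl, rfl⟩ := radix_inj hc' hc h2
      exact hm.code hi (by rw [pow_succ]; omega) hr hc
    · simp at hy
  · exact ⟨_, List.mem_append_left _ (mem_mmForAll.2 ⟨t, ht, h, hh, k', hk', l, hl, r, hr, c, hc,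
      List.mem_cons_self⟩), rfl⟩

theorem OperandsReady.ups {k n : ℕ} {f g : ℕ → ℕ → R} {m : MMCell → R} (hn : n ≤ mmDepth k)
    (hm : OperandsReady k f g n m) :
    OperandsReady k f g 0 (execSteps m ((List.range n).reverse.map (mmUp k))) := by
  induction n generalizing m with
  | zero => exact hm
  | succ n ih =>
    rw [List.range_succ, List.reverse_append, List.reverse_singleton, List.singleton_append,
      List.map_cons]
    exact ih (by omega) (hm.up (by omega))

/-- An `N × N` matrix as a function on natural numbers. -/
def matrixFun {N : ℕ} (f : Fin N → Fin N → R) (r c : ℕ) : R :=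
  if h : r < N ∧ c < N then f ⟨r, h.1⟩ ⟨c, h.2⟩ else 0

theorem factorsReady_initMem (k : ℕ) (val : Entry (2 ^ k) → R) :
    FactorsReady k (matrixFun fun i j => val (.a i j)) (matrixFun fun i j => val (.b i j)) 0
      ((mmProgram k).initMem val) := by
  intro t ht r hr c hc
  have ht : t = 0 := by simpa using ht
  subst ht
  have h : r < 2 ^ k ∧ c < 2 ^ k := ⟨hr, hc⟩
  simp [Program.initMem, mmProgram, mmInit, leftFactor, rightFactor, matrixFun, h]

theorem FactorsReady.execSteps_eq {k : ℕ} {f g : ℕ → ℕ → R} {m : MMCell → R}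
    (hm : FactorsReady k f g 0 m) {i j : ℕ} (hi : i < 2 ^ k) (hj : j < 2 ^ k) :
    execSteps m ((List.range (mmDepth k)).map (mmDown k)
      ++ ((List.range (mmDepth k)).reverse.map (mmUp k) ++ [mmFinal k])) (.m 0 0 i j)
      = subproduct k f g 0 0 i j := by
  have h1 := hm.downs (mmDepth_le k)
  have h2 : OperandsReady k f g (mmDepth k)
      (execSteps m ((List.range (mmDepth k)).map (mmDown k))) := by
    rw [OperandsReady, if_pos rfl]
    exact h1
  have h3 := (h2.ups le_rfl).code (Nat.zero_le _) (t := 0) (by simp) hi hj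
  rw [← h3, execSteps_append, execSteps_append, execSteps_singleton]
  refine deliver_invariant (fun y v => y = .m 0 0 i j → v = execCode _ (mmCode k 0) (.m 0 0 i j))
    _ _ _ (fun y hy => by rw [hy]; rfl) (fun e he hy => ?_) _ rfl
  obtain ⟨_, _, rfl⟩ := mem_mmDummy he
  simp at hy

theorem mmProgram_correct (k : ℕ) : (mmProgram k).Correct := by
  intro R _ A B i j
  refine ((factorsReady_initMem k (entryVal A B)).execSteps_eq i.2 j.2).trans ?_
  rw [subproduct, Matrix.mul_apply, ← Fin.sum_univ_eq_sum_range (fun s =>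
    leftFactor k (matrixFun fun i j => entryVal A B (.a i j)) 0 0 i s *
      rightFactor k (matrixFun fun i j => entryVal A B (.b i j)) 0 0 s j)]
  refine Finset.sum_congr rfl fun s _ => ?_
  have hs : (s : ℕ) < 2 ^ k := s.2
  simp [leftFactor, rightFactor, matrixFun, entryVal, i.2, j.2, hs]

theorem mmProgram_noReplication (k : ℕ) : (mmProgram k).NoReplication := by
  have key : ∀ (c : MMCell) (x : Entry (2 ^ k)), mmInit k c = some x →
      c = match x with
        | .a i j => .a 0 0 i j
        | .b i j => .b 0 0 i j := by
    intro c x h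
    unfold mmInit at h
    split at h
    · split_ifs at h
      cases h
      rfl
    · split_ifs at h
      cases h
      rfl
    · cases h
  intro c c' x h h'
  exact (key c x h).trans (key c' x h').symm

end MatrixProgram

/-! ### Membership of the foldings in the class. -/

section Membership

theorem Program.Valid.fold {N : ℕ} {P : Program N} {b e : ℕ} (hP : P.Valid (b + e)) :
    (P.fold e).Valid b where
  home_lt c := Nat.div_lt_of_lt_mul (by
    have := hP.home_lt c
    rwa [pow_add, mul_comm] at this)
  code_local s hs I hI := by
    have := hP.isLocal hs I hI
    cases I with
    | zero d => trivial
    | one d => trivial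
    | add d x y => exact ⟨congrArg (· / 2 ^ e) this.1, congrArg (· / 2 ^ e) this.2⟩
    | mul d x y => exact ⟨congrArg (· / 2 ^ e) this.1, congrArg (· / 2 ^ e) this.2⟩
  msgs_cluster s hs x hx := by
    have h := hP.msgs_cluster s hs x hx
    -- Subtraction is truncated: for labels above b the left side can be larger. The new clusters
    -- are then coarser than the old ones, which is all that is needed.
    obtain ⟨d, hd⟩ : ∃ d, e + (b - s.label) = (b + e - s.label) + d :=
      ⟨e + (b - s.label) - (b + e - s.label), by omega⟩
    have key : ∀ y : ℕ, y / 2 ^ e / 2 ^ (b - s.label) = y / 2 ^ (b + e - s.label) / 2 ^ d := by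
      intro y
      rw [Nat.div_div_eq_div_mul, Nat.div_div_eq_div_mul, ← pow_add, ← pow_add, hd]
    exact ((key _).trans (congrArg (· / 2 ^ d) h)).trans (key _).symm

theorem pos_lt {k i r c : ℕ} (hr : r < 2 ^ (k - i)) (hc : c < 2 ^ (k - i)) :
    r * 2 ^ (k - i) + c < 4 ^ (k - i) := by
  have h4 : 4 ^ (k - i) = 2 ^ (k - i) * 2 ^ (k - i) := by rw [← mul_pow]; norm_num
  rw [h4]
  calc r * 2 ^ (k - i) + c < r * 2 ^ (k - i) + 2 ^ (k - i) := by omega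
    _ = (r + 1) * 2 ^ (k - i) := by ring
    _ ≤ _ := Nat.mul_le_mul_right _ hr

theorem pos_lt_total {k i t r c : ℕ} (hi : i ≤ k) (ht : t < 8 ^ i) (hr : r < 2 ^ (k - i))
    (hc : c < 2 ^ (k - i)) :
    t * 4 ^ (k - i) + r * 2 ^ (k - i) + c < 2 ^ i * 4 ^ k := by
  have h1 := pos_lt hr hc
  have h2 : (t + 1) * 4 ^ (k - i) ≤ 8 ^ i * 4 ^ (k - i) := Nat.mul_le_mul_right _ ht
  have h3 : 8 ^ i * 4 ^ (k - i) = 2 ^ i * 4 ^ k := by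
    conv_rhs => rw [← Nat.add_sub_cancel' hi, pow_add, ← mul_assoc, ← mul_pow]
    norm_num
  rw [← h3]
  linarith

theorem mmOwner_eq {k i t r c : ℕ} (hi : i ≤ k) (ht : t < 8 ^ i) (hr : r < 2 ^ (k - i))
    (hc : c < 2 ^ (k - i)) :
    mmOwner k i t r c = (t * 4 ^ (k - i) + r * 2 ^ (k - i) + c) / 2 ^ i :=
  Nat.mod_eq_of_lt (Nat.div_lt_of_lt_mul (pos_lt_total hi ht hr hc))

/-- A subproblem has 2^(2(k-i)) positions, 2^i per virtual processor; a sufficiently long shift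
forgets the position and keeps leading digits of t. This one computation yields the clusters of the
messages, the locality of the last level, and the load. -/
theorem mmOwner_div {k i t r c w d : ℕ} (hi : i ≤ k) (ht : t < 8 ^ i) (hr : r < 2 ^ (k - i))
    (hc : c < 2 ^ (k - i)) (hw : i + w = 2 * (k - i) + d) :
    mmOwner k i t r c / 2 ^ w = t / 2 ^ d := by
  rw [mmOwner_eq hi ht hr hc, Nat.div_div_eq_div_mul, ← pow_add, hw, pow_add,
    ← Nat.div_div_eq_div_mul, pow_mul, add_assoc, mul_comm t]
  norm_num
  rw [Nat.mul_add_div (by positivity), Nat.div_eq_of_lt (pos_lt hr hc), add_zero]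

theorem quadrant_lt {k i h x : ℕ} (hi : i < k) (hh : h < 2) (hx : x < 2 ^ (k - (i + 1))) :
    h * 2 ^ (k - (i + 1)) + x < 2 ^ (k - i) := by
  rw [two_pow_sub hi]
  have : h * 2 ^ (k - (i + 1)) ≤ 1 * 2 ^ (k - (i + 1)) := Nat.mul_le_mul_right _ (by omega)
  omega

theorem child_lt {i t h k' l : ℕ} (ht : t < 8 ^ i) (hh : h < 2) (hk : k' < 2) (hl : l < 2) :
    8 * t + (4 * h + 2 * k' + l) < 8 ^ (i + 1) := by
  rw [pow_succ]; omega

theorem four_pow_div {k i : ℕ} (hi : 3 * i < 2 * k) :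
    4 ^ k / 2 ^ (3 * i + 1) = 2 ^ (2 * k - (3 * i + 1)) := by
  rw [show (4 : ℕ) = 2 ^ 2 by norm_num, ← pow_mul, Nat.pow_div (by omega) (by norm_num)]

theorem four_pow_eq (k : ℕ) : 4 ^ k = 2 ^ (2 * k) := by
  rw [pow_mul]; norm_num

theorem mmHome_lt (k : ℕ) (c : MMCell) : mmHome k c < 2 ^ (2 * k) := by
  rw [← four_pow_eq]
  have : 0 < 4 ^ k := by positivity
  cases c <;> exact Nat.mod_lt _ this

theorem dummy_cluster {k i j : ℕ} (hi : 3 * i < 2 * k) (hj : j < 4 ^ k / 2 ^ (3 * i + 1)) :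
    mmHome k (.dummy j) / 2 ^ (2 * k - 3 * i)
      = mmHome k (.dummy (j + 4 ^ k / 2 ^ (3 * i + 1))) / 2 ^ (2 * k - 3 * i) := by
  rw [four_pow_div hi] at hj ⊢
  have h1 : 2 ^ (2 * k - 3 * i) = 2 * 2 ^ (2 * k - (3 * i + 1)) := by
    rw [← pow_succ']; congr 1; omega
  rw [Nat.div_eq_of_lt, Nat.div_eq_of_lt]
  · exact (Nat.mod_le _ _).trans_lt (by omega)
  · exact (Nat.mod_le _ _).trans_lt (by omega)

theorem mem_mmSteps {k : ℕ} {s : Superstep MMCell} (hs : s ∈ (mmProgram k).steps) :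
    (∃ i < mmDepth k, s = mmDown k i) ∨ (∃ i < mmDepth k, s = mmUp k i) ∨ s = mmFinal k := by
  change s ∈ (List.range (mmDepth k)).map (mmDown k)
    ++ ((List.range (mmDepth k)).reverse.map (mmUp k) ++ [mmFinal k]) at hs
  simp only [List.mem_append, List.mem_map, List.mem_range, List.mem_reverse,
    List.mem_singleton] at hs
  rcases hs with ⟨i, hi, rfl⟩ | ⟨i, hi, rfl⟩ | rfl
  · exact Or.inl ⟨i, hi, rfl⟩
  · exact Or.inr (Or.inl ⟨i, hi, rfl⟩)
  · exact Or.inr (Or.inr rfl)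

theorem mmCode_isLocal {k i : ℕ} {I : Instr MMCell} (hI : I ∈ mmCode k i) :
    I.IsLocal (mmHome k) := by
  obtain ⟨t, ht, r, hr, c, hc, hI⟩ := mem_mmCode.1 hI
  unfold mmBlock at hI
  split_ifs at hI with h
  · have hD := mmDepth_bounds k
    have hk := mmDepth_le k
    -- On the last level 3i ≥ 2k, so each subproblem lies within a single virtual processor.
    have key : ∀ r < 2 ^ (k - i), ∀ c < 2 ^ (k - i),
        mmOwner k i t r c = t / 2 ^ (i - 2 * (k - i)) := by
      intro r hr c hc
      have := mmOwner_div (w := 0) (d := i - 2 * (k - i)) (by omega) ht hr hc (by omega)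
      simpa using this
    simp only [List.mem_cons, List.mem_flatMap, List.mem_range, List.not_mem_nil, or_false] at hI
    rcases hI with rfl | ⟨s, hs, rfl | rfl⟩
    · trivial
    · exact ⟨(key r hr s hs).trans (key r hr c hc).symm, (key s hs c hc).trans (key r hr c hc).symm⟩
    · exact ⟨rfl, rfl⟩
  · rw [List.mem_singleton.1 hI]
    exact ⟨rfl, rfl⟩

theorem mmProgram_valid {k : ℕ} (hk : 0 < k) : (mmProgram k).Valid (2 * k) where
  home_lt := mmHome_lt k
  code_local s hs I hI := by
    have : ∃ i, I ∈ mmCode k i := by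
      rcases mem_mmSteps hs with ⟨i, _, rfl⟩ | ⟨i, _, rfl⟩ | rfl
      · exact (List.not_mem_nil hI).elim
      · exact ⟨_, hI⟩
      · exact ⟨_, hI⟩
    obtain ⟨i, hI⟩ := this
    have := mmCode_isLocal hI
    cases I <;> exact this
  msgs_cluster s hs e he := by
    rcases mem_mmSteps hs with ⟨i, hi, rfl⟩ | ⟨i, hi, rfl⟩ | rfl
    · obtain ⟨hik, hi3⟩ := lt_of_lt_mmDepth hi
      rcases mem_mmDown he with
        ⟨t, ht, h, hh, k', hk', l, hl, r, hr, c, hc, rfl | rfl⟩ | ⟨j, hj, rfl⟩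
      · refine (mmOwner_div (d := 0) hik.le ht (quadrant_lt hik hh hr) (quadrant_lt hik hl hc)
          (by change i + (2 * k - 3 * i) = _; omega)).trans (Eq.trans ?_ (mmOwner_div (d := 3) hik
          (child_lt ht hh hk' hl) hr hc (by change i + 1 + (2 * k - 3 * i) = _; omega)).symm)
        omega
      · refine (mmOwner_div (d := 0) hik.le ht (quadrant_lt hik hl hr) (quadrant_lt hik hk' hc)
          (by change i + (2 * k - 3 * i) = _; omega)).trans (Eq.trans ?_ (mmOwner_div (d := 3) hik
          (child_lt ht hh hk' hl) hr hc (by change i + 1 + (2 * k - 3 * i) = _; omega)).symm)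
        omega
      · exact dummy_cluster hi3 hj
    · obtain ⟨hik, hi3⟩ := lt_of_lt_mmDepth hi
      rcases mem_mmUp he with
        ⟨t, ht, h, hh, k', hk', l, hl, r, hr, c, hc, rfl⟩ | ⟨j, hj, rfl⟩
      · refine ((mmOwner_div (d := 3) hik (child_lt ht hh hk' hl) hr hc
          (by change i + 1 + (2 * k - 3 * i) = _; omega)).trans ?_).trans
          (mmOwner_div (d := 0) hik.le ht (quadrant_lt hik hh hr) (quadrant_lt hik hk' hc)
          (by change i + (2 * k - 3 * i) = _; omega)).symm
        omega
      · exact dummy_cluster hi3 hj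
    · obtain ⟨j, hj, rfl⟩ := mem_mmDummy he
      exact dummy_cluster (i := 0) (by omega) hj

/-- Products are only computed right after the distribution of the inputs. -/
theorem before_eq_downs {k : ℕ} {before after : List (Superstep MMCell)} {s : Superstep MMCell}
    (hk : 0 < k) (hs : (mmProgram k).steps = before ++ s :: after) {d x y : MMCell}
    (hmul : Instr.mul d x y ∈ s.code) :
    before = (List.range (mmDepth k)).map (mmDown k) ∧ s.code = mmCode k (mmDepth k) := by
  have hD : 0 < mmDepth k := by have := mmDepth_bounds k; omega
  obtain ⟨D, hDD⟩ : ∃ D, mmDepth k = D + 1 := ⟨mmDepth k - 1, by omega⟩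
  have hnomul : ∀ i, i ≠ mmDepth k → Instr.mul d x y ∉ mmCode k i := by
    intro i hi h
    obtain ⟨t, _, r, _, c, _, h⟩ := mem_mmCode.1 h
    rw [mmBlock, if_neg hi] at h
    simp at h
  have hs' : (List.range (mmDepth k)).map (mmDown k)
      ++ mmUp k D :: ((List.range D).reverse.map (mmUp k) ++ [mmFinal k]) = before ++ s :: after := by
    rw [← hs]
    change _ = (List.range (mmDepth k)).map (mmDown k)
      ++ ((List.range (mmDepth k)).reverse.map (mmUp k) ++ [mmFinal k])
    rw [hDD, List.range_succ (n := D), List.reverse_append, List.reverse_singleton,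
      List.singleton_append, List.map_cons, List.cons_append]
  rcases List.append_eq_append_iff.1 hs' with ⟨l, h1, h2⟩ | ⟨l, h1, h2⟩
  · rcases l with _ | ⟨u, l⟩
    · simp only [List.nil_append, List.cons.injEq] at h2
      refine ⟨by simpa using h1, ?_⟩
      rw [← h2.1, hDD]
      rfl
    · exfalso
      simp only [List.cons_append, List.cons.injEq] at h2
      have hmem : s ∈ (List.range D).reverse.map (mmUp k) ++ [mmFinal k] := by rw [h2.2]; simp
      rcases List.mem_append.1 hmem with hmem | hmem
      · obtain ⟨i, hi, rfl⟩ := List.mem_map.1 hmem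
        have := List.mem_range.1 (List.mem_reverse.1 hi)
        exact hnomul (i + 1) (by omega) hmul
      · rw [List.mem_singleton.1 hmem] at hmul
        exact hnomul 0 (by omega) hmul
  · rcases l with _ | ⟨u, l⟩
    · simp only [List.nil_append, List.cons.injEq] at h2
      refine ⟨by simpa using h1.symm, ?_⟩
      rw [h2.1, hDD]
      rfl
    · exfalso
      simp only [List.cons_append, List.cons.injEq] at h2
      have hmem : s ∈ (List.range (mmDepth k)).map (mmDown k) := by rw [h1, h2.1]; simp
      obtain ⟨i, hi, rfl⟩ := List.mem_map.1 hmem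
      simp [mmDown] at hmul

/-- Multiplications occur only in the sequential code of the last level, which never overwrites the
factors; their operands are thus the factors as distributed. -/
theorem termsComputed_mmProgram_fold {k e q : ℕ} (hk : 0 < k)
    {τ : Fin (2 ^ k) × Fin (2 ^ k) × Fin (2 ^ k)}
    (hτ : τ ∈ ((mmProgram k).fold e).termsComputed q) :
    ∃ t < 8 ^ mmDepth k, ∃ r < 2 ^ (k - mmDepth k), ∃ s < 2 ^ (k - mmDepth k),
      ∃ c < 2 ^ (k - mmDepth k), mmOwner k (mmDepth k) t r c / 2 ^ e = q ∧
      leftFactor k (matrixFun fun i j => FreeAlgebra.ι ℕ (Entry.a i j)) (mmDepth k) t r s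
        = FreeAlgebra.ι ℕ (Entry.a τ.1 τ.2.1) ∧
      rightFactor k (matrixFun fun i j => FreeAlgebra.ι ℕ (Entry.b i j)) (mmDepth k) t s c
        = FreeAlgebra.ι ℕ (Entry.b τ.2.1 τ.2.2) := by
  obtain ⟨before, after, s, pre, post, d, x, y, hs, hc, hd, hx, hy⟩ :
      ∃ (before after : List (Superstep MMCell)) (s : Superstep MMCell)
        (pre post : List (Instr MMCell)) (d x y : MMCell),
        (mmProgram k).steps = before ++ s :: after ∧ s.code = pre ++ Instr.mul d x y :: post ∧
        mmHome k d / 2 ^ e = q ∧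
        execCode (execSteps (γ := MMCell) ((mmProgram k).initMem (FreeAlgebra.ι ℕ)) before) pre x
          = FreeAlgebra.ι ℕ (Entry.a τ.1 τ.2.1) ∧
        execCode (execSteps (γ := MMCell) ((mmProgram k).initMem (FreeAlgebra.ι ℕ)) before) pre y
          = FreeAlgebra.ι ℕ (Entry.b τ.2.1 τ.2.2) := hτ
  obtain ⟨h1, h2⟩ := before_eq_downs hk (s := s) hs (d := d) (x := x) (y := y) (by rw [hc]; simp)
  have hmem : Instr.mul d x y ∈ mmCode k (mmDepth k) := by rw [← h2, hc]; simp
  obtain ⟨t, ht, r, hr, c, hc', hI⟩ := mem_mmCode.1 hmem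
  rw [mmBlock, if_pos rfl] at hI
  simp only [List.mem_cons, List.mem_flatMap, List.mem_range, List.not_mem_nil, or_false,
    reduceCtorEq, false_or, Instr.mul.injEq] at hI
  obtain ⟨s', hs', rfl, rfl, rfl⟩ := hI
  have hready := (factorsReady_initMem k (FreeAlgebra.ι ℕ)).downs (mmDepth_le k)
  have hkeep : ∀ z : MMCell, (∀ t r c, z ≠ .m (mmDepth k) t r c) →
      (∀ t r c, z ≠ .tmp (mmDepth k) t r c) → ∀ m : MMCell → FreeAlgebra ℕ (Entry (2 ^ k)),
      execCode m pre z = m z := by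
    intro z hz1 hz2 m
    refine execCode_of_ne_dest _ _ _ fun I hI => ?_
    have : I ∈ mmCode k (mmDepth k) := by rw [← h2, hc]; simp [hI]
    obtain ⟨t, _, r, _, c, _, hI⟩ := mem_mmCode.1 this
    rcases dest_of_mem_mmBlock hI with h | h
    · exact h ▸ (hz1 t r c).symm
    · exact h ▸ (hz2 t r c).symm
  refine ⟨t, ht, r, hr, s', hs', c, hc', hd, ?_, ?_⟩
  · rw [← hx, ← (hready t ht r hr s' hs').1]
    subst h1
    exact (hkeep _ (by simp) (by simp) _).symm
  · rw [← hy, ← (hready t ht s' hs' c hc').2]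
    subst h1
    exact (hkeep _ (by simp) (by simp) _).symm

/-- With D the depth, a virtual processor has 2^(3D-2k) subproblems of the last level, folding
multiplies this by 2^(2k-a), and each subproblem performs 2^(3(k-D)) multiplications, each
accounting for at most one term. -/
theorem ncard_termsComputed_le {k a q : ℕ} (hk : 0 < k) (ha : a ≤ 2 * k) :
    (((mmProgram k).fold (2 * k - a)).termsComputed q).ncard ≤ 2 ^ (3 * k - a) := by
  classical
  set D := mmDepth k with hD
  have hb := mmDepth_bounds k
  have hDk := mmDepth_le k
  set E := 3 * D - 2 * k + (2 * k - a)
  set n := 2 ^ (k - D)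
  let T : Finset (ℕ × ℕ × ℕ × ℕ) := Finset.Ico (q * 2 ^ E) (q * 2 ^ E + 2 ^ E) ×ˢ
    (Finset.range n ×ˢ (Finset.range n ×ˢ Finset.range n))
  have hT : T.card = 2 ^ (3 * k - a) := by
    simp only [T, Finset.card_product, Nat.card_Ico, Finset.card_range, add_tsub_cancel_left, n]
    rw [← pow_add, ← pow_add, ← pow_add]
    congr 1
    omega
  rw [← hT, Set.ncard_eq_toFinset_card _ (Set.toFinite _)]
  refine Finset.card_le_card_of_forall_subsingleton (fun τ σ =>
      leftFactor k (matrixFun fun i j => FreeAlgebra.ι ℕ (Entry.a i j)) D σ.1 σ.2.1 σ.2.2.1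
        = FreeAlgebra.ι ℕ (Entry.a τ.1 τ.2.1) ∧
      rightFactor k (matrixFun fun i j => FreeAlgebra.ι ℕ (Entry.b i j)) D σ.1 σ.2.2.1 σ.2.2.2
        = FreeAlgebra.ι ℕ (Entry.b τ.2.1 τ.2.2)) (fun τ hτ => ?_) ?_
  · obtain ⟨t, ht, r, hr, s, hs, c, hc, hq, h1, h2⟩ :=
      termsComputed_mmProgram_fold hk ((Set.Finite.mem_toFinset _).1 hτ)
    refine ⟨(t, r, s, c), ?_, h1, h2⟩
    have hq' : t / 2 ^ E = q := by
      rw [← hq]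
      exact (mmOwner_div hDk ht hr hc (by omega)).symm
    simp only [T, Finset.mem_product, Finset.mem_Ico, Finset.mem_range]
    refine ⟨?_, hr, hs, hc⟩
    have h3 := Nat.div_add_mod' t (2 ^ E)
    have h4 := Nat.mod_lt t (Nat.two_pow_pos E)
    rw [hq'] at h3
    constructor <;> omega
  · rintro σ _ ⟨i, k1, j⟩ ⟨_, h1, h2⟩ ⟨i', k1', j'⟩ ⟨_, h1', h2'⟩
    have e1 := FreeAlgebra.ι_injective (h1.symm.trans h1')
    have e2 := FreeAlgebra.ι_injective (h2.symm.trans h2')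
    simp only [Entry.a.injEq, Entry.b.injEq] at e1 e2
    simp [e1.1, e1.2, e2.2]

theorem mmProgram_fold_mem {k a : ℕ} (ha : 0 < a) (hak : a ≤ 2 * k) :
    MMClass a ((mmProgram k).fold (2 * k - a)) := by
  induction a using Nat.strong_induction_on with
  | _ a ih =>
    have hk : 0 < k := by omega
    refine MMClass.intro a _ ?_ (mmProgram_correct k) (mmProgram_noReplication k) ?_ ?_
    · refine Program.Valid.fold ?_
      rw [Nat.add_sub_cancel' hak]
      exact mmProgram_valid hk
    · intro r _
      have h1 : (((((mmProgram k).fold (2 * k - a)).termsComputed r).ncard : ℕ) : ℝ)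
          ≤ 2 ^ (3 * k - a) := by exact_mod_cast ncard_termsComputed_le hk hak
      refine h1.trans ?_
      have h2 : (2 : ℝ) ^ (3 * k - a) = ((2 ^ k : ℕ) : ℝ) ^ 3 / 2 ^ a := by
        rw [eq_div_iff (by positivity), ← pow_add]
        push_cast
        rw [← pow_mul]
        congr 1
        omega
      rw [h2]
      exact div_le_div_of_nonneg_left (by positivity) (by positivity) (min_le_left _ _)
    · intro b hb hba
      rw [Program.fold_fold, show 2 * k - a + (a - b) = 2 * k - b by omega]
      exact ih b hba hb (by omega)

end Membership

/-! ### Degrees and communication time of the recursive algorithm. -/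

section Degrees

theorem countP_le_of_key {α : Type} {L : List α} (hL : L.Nodup) (p : α → Bool)
    (key : α → ℕ × ℕ) (hinj : ∀ x ∈ L, ∀ y ∈ L, key x = key y → x = y) (E m q : ℕ)
    (hkey : ∀ x ∈ L, p x → (key x).1 / 2 ^ E = q ∧ (key x).2 < m) :
    L.countP p ≤ m * 2 ^ E := by
  classical
  rw [List.countP_eq_length_filter, ← List.toFinset_card_of_nodup (hL.filter _)]
  have hcard : (Finset.Ico (q * 2 ^ E) (q * 2 ^ E + 2 ^ E) ×ˢ Finset.range m).card = m * 2 ^ E := by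
    rw [Finset.card_product, Nat.card_Ico, Finset.card_range, Nat.add_sub_cancel_left, mul_comm]
  rw [← hcard]
  refine Finset.card_le_card_of_injOn key (fun x hx => ?_) fun x hx y hy h => ?_
  · have hx := List.mem_filter.1 (List.mem_toFinset.1 hx)
    obtain ⟨h1, h2⟩ := hkey x hx.1 hx.2
    refine Finset.mem_coe.2 (Finset.mem_product.2
      ⟨Finset.mem_Ico.2 ?_, Finset.mem_range.2 h2⟩)
    have h3 := Nat.div_add_mod' (key x).1 (2 ^ E)
    have h4 := Nat.mod_lt (key x).1 (Nat.two_pow_pos E)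
    rw [h1] at h3
    constructor <;> omega
  · exact hinj x (List.mem_filter.1 (List.mem_toFinset.1 hx)).1 y
      (List.mem_filter.1 (List.mem_toFinset.1 hy)).1 h

theorem pos_inj {k i t r c t' r' c' : ℕ} (hr : r < 2 ^ (k - i)) (hc : c < 2 ^ (k - i))
    (hr' : r' < 2 ^ (k - i)) (hc' : c' < 2 ^ (k - i))
    (h : t * 4 ^ (k - i) + r * 2 ^ (k - i) + c = t' * 4 ^ (k - i) + r' * 2 ^ (k - i) + c') :
    t = t' ∧ r = r' ∧ c = c' := by
  have h4 : 4 ^ (k - i) = 2 ^ (k - i) * 2 ^ (k - i) := by rw [← mul_pow]; norm_num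
  rw [h4, ← mul_assoc, ← mul_assoc, ← add_mul, ← add_mul] at h
  obtain ⟨h1, h2⟩ := radix_inj hc hc' h
  obtain ⟨h3, h5⟩ := radix_inj hr hr' h1
  exact ⟨h3, h5, h2⟩

/-- A folded processing element owns at most 2^(j+e) positions of level j; `X` tells apart the at
most m messages at one position. -/
theorem countP_owner_le {α : Type} {L : List α} (hL : L.Nodup) {k j e q m : ℕ} (hj : j ≤ k)
    (p : α → Bool) (T r c X : α → ℕ) (hT : ∀ x ∈ L, T x < 8 ^ j)
    (hr : ∀ x ∈ L, r x < 2 ^ (k - j)) (hc : ∀ x ∈ L, c x < 2 ^ (k - j)) (hX : ∀ x ∈ L, X x < m)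
    (hinj : ∀ x ∈ L, ∀ y ∈ L, T x = T y → r x = r y → c x = c y → X x = X y → x = y)
    (hp : ∀ x ∈ L, p x → mmOwner k j (T x) (r x) (c x) / 2 ^ e = q) :
    L.countP p ≤ m * 2 ^ (j + e) := by
  refine countP_le_of_key hL p
    (fun x => (T x * 4 ^ (k - j) + r x * 2 ^ (k - j) + c x, X x)) (fun x hx y hy h => ?_)
    (j + e) m q fun x hx hpx => ⟨?_, hX x hx⟩
  · simp only [Prod.mk.injEq] at h
    obtain ⟨h1, h2, h3⟩ := pos_inj (hr x hx) (hc x hx) (hr y hy) (hc y hy) h.1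
    exact hinj x hx y hy h1 h2 h3 h.2
  · rw [← hp x hx hpx, mmOwner_eq hj (hT x hx) (hr x hx) (hc x hx), Nat.div_div_eq_div_mul,
      ← pow_add]

/-- The index tuples of `mmForAll`. -/
def mmTuples (k i : ℕ) : List (ℕ × ℕ × ℕ × ℕ × ℕ × ℕ) :=
  List.range (8 ^ i) ×ˢ (List.range 2 ×ˢ (List.range 2 ×ˢ (List.range 2 ×ˢ
    (List.range (2 ^ (k - (i + 1))) ×ˢ List.range (2 ^ (k - (i + 1)))))))

theorem mmForAll_eq {α : Type} (k i : ℕ) (f : ℕ → ℕ → ℕ → ℕ → ℕ → ℕ → List α) :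
    mmForAll k i f = (mmTuples k i).flatMap fun τ =>
      f τ.1 τ.2.1 τ.2.2.1 τ.2.2.2.1 τ.2.2.2.2.1 τ.2.2.2.2.2 := by
  simp only [mmForAll, mmTuples, SProd.sprod, List.product, List.flatMap_assoc, List.flatMap_map]

theorem mmTuples_nodup (k i : ℕ) : (mmTuples k i).Nodup := by
  unfold mmTuples
  repeat' first | exact List.nodup_range | apply List.Nodup.product

theorem mem_mmTuples {k i : ℕ} {t h k' l r c : ℕ} : (t, h, k', l, r, c) ∈ mmTuples k i ↔
    t < 8 ^ i ∧ h < 2 ∧ k' < 2 ∧ l < 2 ∧ r < 2 ^ (k - (i + 1)) ∧ c < 2 ^ (k - (i + 1)) := by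
  simp only [mmTuples, SProd.sprod, List.pair_mem_product, List.mem_range]

theorem countP_flatMap_singleton {α β : Type} (L : List α) (x : α → β) (p : β → Bool) :
    (L.flatMap fun τ => [x τ]).countP p = L.countP fun τ => p (x τ) := by
  induction L with
  | nil => rfl
  | cons a L ih => simp [List.countP_cons, ih]

theorem countP_flatMap_pair {α β : Type} (L : List α) (x y : α → β) (p : β → Bool) :
    (L.flatMap fun τ => [x τ, y τ]).countP p
      = (L.countP fun τ => p (x τ)) + L.countP fun τ => p (y τ) := by
  induction L with
  | nil => rfl
  | cons a L ih => simp [List.countP_cons, ih]; omega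

theorem countP_flatMap_replicate {α β : Type} (L : List α) (n : ℕ) (x : α → β) (p : β → Bool) :
    (L.flatMap fun j => List.replicate n (x j)).countP p = n * L.countP fun j => p (x j) := by
  induction L with
  | nil => rfl
  | cons a L ih =>
    rw [List.flatMap_cons, List.countP_append, ih, List.countP_cons, List.countP_replicate]
    split_ifs <;> ring

variable {k i e q : ℕ}

/-- A position on level i fixes its quadrant (u, v) and the place in it; only the remaining bit w is
free, whence the factor 2. -/
theorem countP_quadrant_le (hi : i < k) (p : ℕ × ℕ × ℕ × ℕ × ℕ × ℕ → Bool)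
    (u v w : ℕ × ℕ × ℕ × ℕ × ℕ × ℕ → ℕ) (hu : ∀ τ ∈ mmTuples k i, u τ < 2)
    (hv : ∀ τ ∈ mmTuples k i, v τ < 2) (hw : ∀ τ ∈ mmTuples k i, w τ < 2)
    (huvw : ∀ t h k' l r c h' k'' l', u (t, h, k', l, r, c) = u (t, h', k'', l', r, c) →
      v (t, h, k', l, r, c) = v (t, h', k'', l', r, c) →
      w (t, h, k', l, r, c) = w (t, h', k'', l', r, c) → h = h' ∧ k' = k'' ∧ l = l')
    (hp : ∀ t h k' l r c, p (t, h, k', l, r, c) →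
      mmOwner k i t (u (t, h, k', l, r, c) * 2 ^ (k - (i + 1)) + r)
        (v (t, h, k', l, r, c) * 2 ^ (k - (i + 1)) + c) / 2 ^ e = q) :
    (mmTuples k i).countP p ≤ 2 * 2 ^ (i + e) := by
  refine countP_owner_le (q := q) (mmTuples_nodup k i) hi.le p (fun τ => τ.1)
    (fun τ => u τ * 2 ^ (k - (i + 1)) + τ.2.2.2.2.1)
    (fun τ => v τ * 2 ^ (k - (i + 1)) + τ.2.2.2.2.2) w ?_ ?_ ?_ hw ?_ ?_
  · rintro ⟨t, h, k', l, r, c⟩ hτ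
    exact (mem_mmTuples.1 hτ).1
  · rintro ⟨t, h, k', l, r, c⟩ hτ
    exact quadrant_lt hi (hu _ hτ) (mem_mmTuples.1 hτ).2.2.2.2.1
  · rintro ⟨t, h, k', l, r, c⟩ hτ
    exact quadrant_lt hi (hv _ hτ) (mem_mmTuples.1 hτ).2.2.2.2.2
  · rintro ⟨t, h, k', l, r, c⟩ hτ ⟨t', h', k'', l', r', c'⟩ hτ' h1 h2 h3 h4
    obtain ⟨_, _, _, _, hr, hc⟩ := mem_mmTuples.1 hτ
    obtain ⟨_, _, _, _, hr', hc'⟩ := mem_mmTuples.1 hτ'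
    dsimp only at h1 h2 h3 h4
    obtain ⟨h2, rfl⟩ := radix_inj hr hr' h2
    obtain ⟨h3, rfl⟩ := radix_inj hc hc' h3
    subst h1
    obtain ⟨rfl, rfl, rfl⟩ := huvw _ _ _ _ _ _ _ _ _ h2 h3 h4
    rfl
  · rintro ⟨t, h, k', l, r, c⟩ _ hpτ
    exact hp _ _ _ _ _ _ hpτ

/-- A position on level i + 1 determines its tuple completely; the factor 2 is the doubled number of
positions per processor. -/
theorem countP_child_le (hi : i < k) (p : ℕ × ℕ × ℕ × ℕ × ℕ × ℕ → Bool)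
    (hp : ∀ t h k' l r c, p (t, h, k', l, r, c) →
      mmOwner k (i + 1) (8 * t + (4 * h + 2 * k' + l)) r c / 2 ^ e = q) :
    (mmTuples k i).countP p ≤ 2 * 2 ^ (i + e) := by
  have : (mmTuples k i).countP p ≤ 1 * 2 ^ (i + 1 + e) := by
    refine countP_owner_le (q := q) (mmTuples_nodup k i) hi p
      (fun τ => 8 * τ.1 + (4 * τ.2.1 + 2 * τ.2.2.1 + τ.2.2.2.1)) (fun τ => τ.2.2.2.2.1)
      (fun τ => τ.2.2.2.2.2) (fun _ => 0) ?_ ?_ ?_ (fun _ _ => one_pos) ?_ ?_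
    · rintro ⟨t, h, k', l, r, c⟩ hτ
      obtain ⟨h1, h2, h3, h4, _, _⟩ := mem_mmTuples.1 hτ
      exact child_lt h1 h2 h3 h4
    · rintro ⟨t, h, k', l, r, c⟩ hτ
      exact (mem_mmTuples.1 hτ).2.2.2.2.1
    · rintro ⟨t, h, k', l, r, c⟩ hτ
      exact (mem_mmTuples.1 hτ).2.2.2.2.2
    · rintro ⟨t, h, k', l, r, c⟩ hτ ⟨t', h', k'', l', r', c'⟩ hτ' h1 h2 h3 _
      obtain ⟨_, _, _, _, _, _⟩ := mem_mmTuples.1 hτ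
      obtain ⟨_, _, _, _, _, _⟩ := mem_mmTuples.1 hτ'
      dsimp only at h1 h2 h3
      simp only [Prod.mk.injEq]
      omega
    · rintro ⟨t, h, k', l, r, c⟩ _ hpτ
      exact hp _ _ _ _ _ _ hpτ
  refine this.trans (le_of_eq ?_)
  ring

theorem countP_mmDummy_le (hi : 3 * i < 2 * k) (p : MMCell × MMCell → Bool) (d : ℕ)
    (hd : d ≤ 4 ^ k / 2 ^ (3 * i + 1))
    (hp : ∀ j, p (.dummy j, .dummy (j + 4 ^ k / 2 ^ (3 * i + 1))) →
      (j + d) % 4 ^ k / 2 ^ e = q) :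
    (mmDummy k i).countP p ≤ 2 ^ (i + e) := by
  have h4 : 4 ^ k / 2 ^ (3 * i + 1) * 2 ≤ 4 ^ k := by
    rw [four_pow_div hi, ← pow_succ, four_pow_eq]
    exact Nat.pow_le_pow_right (by norm_num) (by omega)
  rw [mmDummy, countP_flatMap_replicate, pow_add 2 i e]
  refine Nat.mul_le_mul_left _ ?_
  rw [← one_mul (2 ^ e)]
  refine countP_le_of_key List.nodup_range _ (fun j => (j + d, 0))
    (fun x _ y _ h => by simpa using h) e 1 q fun j hj hpj => ⟨?_, one_pos⟩
  have hj := List.mem_range.1 hj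
  have := hp j hpj
  rwa [Nat.mod_eq_of_lt (by omega)] at this

/-- Counting messages that stay inside a processing element as well only increases the bound. -/
theorem degree_fold_le_of_countP {N a B : ℕ} {P : Program N} (s : Superstep P.Cell)
    (hsent : ∀ q, (s.msgs.countP fun x => P.home x.1 / 2 ^ e = q) ≤ B)
    (hrecv : ∀ q, (s.msgs.countP fun x => P.home x.2 / 2 ^ e = q) ≤ B) :
    (P.fold e).degree a s ≤ B := by
  refine Finset.sup_le fun q _ => max_le ?_ ?_
  · refine (List.countP_mono_left fun x _ hx => ?_).trans (hsent q)
    exact decide_eq_true (of_decide_eq_true hx).1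
  · refine (List.countP_mono_left fun x _ hx => ?_).trans (hrecv q)
    exact decide_eq_true (of_decide_eq_true hx).1

theorem degree_mmDown_le (hi : i < mmDepth k) (a e : ℕ) :
    ((mmProgram k).fold e).degree a (mmDown k i) ≤ 5 * 2 ^ (i + e) := by
  obtain ⟨hik, hi3⟩ := lt_of_lt_mmDepth hi
  have hlt : ∀ τ ∈ mmTuples k i, τ.2.1 < 2 ∧ τ.2.2.1 < 2 ∧ τ.2.2.2.1 < 2 := by
    rintro ⟨t, h, k', l, r, c⟩ hτ
    obtain ⟨_, h1, h2, h3, _⟩ := mem_mmTuples.1 hτ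
    exact ⟨h1, h2, h3⟩
  refine degree_fold_le_of_countP (P := mmProgram k) (mmDown k i) (fun q => ?_) fun q => ?_
  · change List.countP (fun x => decide (mmHome k x.1 / 2 ^ e = q))
      (mmForAll k i _ ++ mmDummy k i) ≤ _
    rw [List.countP_append, mmForAll_eq, countP_flatMap_pair]
    refine (Nat.add_le_add (Nat.add_le_add (countP_quadrant_le (e := e) (q := q) hik _
      (fun τ => τ.2.1) (fun τ => τ.2.2.2.1) (fun τ => τ.2.2.1) (fun τ hτ => (hlt τ hτ).1)
      (fun τ hτ => (hlt τ hτ).2.2) (fun τ hτ => (hlt τ hτ).2.1)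
      (fun _ _ _ _ _ _ _ _ _ h1 h2 h3 => ⟨h1, h3, h2⟩)
      fun t h k' l r c hp => of_decide_eq_true hp)
      (countP_quadrant_le (e := e) (q := q) hik _ (fun τ => τ.2.2.2.1)
      (fun τ => τ.2.2.1) (fun τ => τ.2.1) (fun τ hτ => (hlt τ hτ).2.2)
      (fun τ hτ => (hlt τ hτ).2.1) (fun τ hτ => (hlt τ hτ).1)
      (fun _ _ _ _ _ _ _ _ _ h1 h2 h3 => ⟨h3, h2, h1⟩)
      fun t h k' l r c hp => of_decide_eq_true hp))
      (countP_mmDummy_le (e := e) (q := q) hi3 _ 0 (Nat.zero_le _)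
        fun j hj => of_decide_eq_true hj)).trans ?_
    -- The constant is 5 = 2 + 2 + 1, from the entries of A, those of B, and the dummy messages.
    omega
  · change List.countP (fun x => decide (mmHome k x.2 / 2 ^ e = q))
      (mmForAll k i _ ++ mmDummy k i) ≤ _
    rw [List.countP_append, mmForAll_eq, countP_flatMap_pair]
    refine (Nat.add_le_add (Nat.add_le_add
      (countP_child_le (e := e) (q := q) hik _ fun t h k' l r c hp => of_decide_eq_true hp)
      (countP_child_le (e := e) (q := q) hik _ fun t h k' l r c hp => of_decide_eq_true hp))
      (countP_mmDummy_le (e := e) (q := q) hi3 _ _ le_rfl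
        fun j hj => of_decide_eq_true hj)).trans ?_
    omega

theorem degree_mmUp_le (hi : i < mmDepth k) (a e : ℕ) :
    ((mmProgram k).fold e).degree a (mmUp k i) ≤ 5 * 2 ^ (i + e) := by
  obtain ⟨hik, hi3⟩ := lt_of_lt_mmDepth hi
  have hlt : ∀ τ ∈ mmTuples k i, τ.2.1 < 2 ∧ τ.2.2.1 < 2 ∧ τ.2.2.2.1 < 2 := by
    rintro ⟨t, h, k', l, r, c⟩ hτ
    obtain ⟨_, h1, h2, h3, _⟩ := mem_mmTuples.1 hτ
    exact ⟨h1, h2, h3⟩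
  refine degree_fold_le_of_countP (P := mmProgram k) (mmUp k i) (fun q => ?_) fun q => ?_
  · change List.countP (fun x => decide (mmHome k x.1 / 2 ^ e = q))
      (mmForAll k i _ ++ mmDummy k i) ≤ _
    rw [List.countP_append, mmForAll_eq, countP_flatMap_singleton]
    refine (Nat.add_le_add
      (countP_child_le (e := e) (q := q) hik _ fun t h k' l r c hp => of_decide_eq_true hp)
      (countP_mmDummy_le (e := e) (q := q) hi3 _ 0 (Nat.zero_le _)
        fun j hj => of_decide_eq_true hj)).trans ?_
    omega
  · change List.countP (fun x => decide (mmHome k x.2 / 2 ^ e = q))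
      (mmForAll k i _ ++ mmDummy k i) ≤ _
    rw [List.countP_append, mmForAll_eq, countP_flatMap_singleton]
    refine (Nat.add_le_add (countP_quadrant_le (e := e) (q := q) hik _
      (fun τ => τ.2.1) (fun τ => τ.2.2.1) (fun τ => τ.2.2.2.1) (fun τ hτ => (hlt τ hτ).1)
      (fun τ hτ => (hlt τ hτ).2.1) (fun τ hτ => (hlt τ hτ).2.2)
      (fun _ _ _ _ _ _ _ _ _ h1 h2 h3 => ⟨h1, h2, h3⟩)
      fun t h k' l r c hp => of_decide_eq_true hp)
      (countP_mmDummy_le (e := e) (q := q) hi3 _ _ le_rfl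
        fun j hj => of_decide_eq_true hj)).trans ?_
    omega

theorem degree_mmFinal_le (hk : 0 < k) (a e : ℕ) :
    ((mmProgram k).fold e).degree a (mmFinal k) ≤ 5 * 2 ^ e := by
  refine degree_fold_le_of_countP (P := mmProgram k) (mmFinal k) (fun q => ?_) fun q => ?_
  · have := countP_mmDummy_le (k := k) (i := 0) (e := e) (q := q) (by omega)
      (fun x => decide (mmHome k x.1 / 2 ^ e = q)) 0 (Nat.zero_le _)
      fun j hj => of_decide_eq_true hj
    rw [zero_add] at this
    exact this.trans (by omega)
  · have := countP_mmDummy_le (k := k) (i := 0) (e := e) (q := q) (by omega)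
      (fun x => decide (mmHome k x.2 / 2 ^ e = q)) _ le_rfl
      fun j hj => of_decide_eq_true hj
    rw [zero_add] at this
    exact this.trans (by omega)

/-- Sums over the supersteps with label `n` in a list of supersteps with the labels `3 i`. -/
theorem sum_filter_label_le (f : ℕ → Superstep MMCell) (hf : ∀ i, (f i).label = 3 * i)
    (d : Superstep MMCell → ℕ) (B : ℕ → ℕ) (D n : ℕ) (hd : ∀ i < D, d (f i) ≤ B i) :
    ((((List.range D).map f).filter fun s => s.label = n).map d).sum
      ≤ if 3 ∣ n then B (n / 3) else 0 := by
  have key : ((((List.range D).map f).filter fun s => s.label = n).map d).sum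
      ≤ if 3 ∣ n ∧ n / 3 < D then B (n / 3) else 0 := by
    induction D with
    | zero => simp
    | succ D ih =>
      have ih := ih fun i hi => hd i (by omega)
      rw [List.range_succ, List.map_append, List.filter_append, List.map_append, List.sum_append]
      by_cases h : 3 * D = n
      · have h0 : ¬ (3 ∣ n ∧ n / 3 < D) := by omega
        have h1 : 3 ∣ n ∧ n / 3 < D + 1 := by omega
        rw [if_neg h0] at ih
        rw [if_pos h1]
        have h2 := hd D (by omega)
        have h3 : n / 3 = D := by omega
        simp only [List.map_cons, List.map_nil, List.filter_cons, hf, h, decide_true, if_true,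
          List.filter_nil, List.sum_cons, List.sum_nil]
        rw [h3]
        omega
      · have h4 : (if 3 ∣ n ∧ n / 3 < D then B (n / 3) else 0)
            ≤ if 3 ∣ n ∧ n / 3 < D + 1 then B (n / 3) else 0 := by
          split_ifs <;> omega
        simp only [List.map_cons, List.map_nil, List.filter_cons, hf, h, decide_false,
          List.filter_nil]
        exact ih.trans h4
  refine key.trans ?_
  split_ifs <;> omega

theorem sum_stepsWithLabel_le {k e n : ℕ} (d : Superstep MMCell → ℕ) (B : ℕ → ℕ)
    (hdown : ∀ i < mmDepth k, d (mmDown k i) ≤ B i) (hup : ∀ i < mmDepth k, d (mmUp k i) ≤ B i)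
    (hfinal : d (mmFinal k) ≤ B 0) :
    ((((mmProgram k).fold e).stepsWithLabel n).map d).sum
      ≤ 3 * if 3 ∣ n then B (n / 3) else 0 := by
  change ((((List.range (mmDepth k)).map (mmDown k)
    ++ ((List.range (mmDepth k)).reverse.map (mmUp k) ++ [mmFinal k])).filter
      fun s => s.label = n).map d).sum ≤ _
  have h1 := sum_filter_label_le (mmDown k) (fun _ => rfl) d B (mmDepth k) n hdown
  have h2 := sum_filter_label_le (mmUp k) (fun _ => rfl) d B (mmDepth k) n hup
  have h3 : (([mmFinal k].filter fun s => s.label = n).map d).sum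
      ≤ if 3 ∣ n then B (n / 3) else 0 := by
    by_cases h : n = 0
    · subst h
      simpa [List.filter_cons, mmFinal] using hfinal
    · have : ¬ (0 = n) := fun h' => h h'.symm
      simp [mmFinal, this]
  -- The factor 3 counts the way down, the way up and the final superstep; only label 0 meets all
  -- three.
  rw [List.filter_append, List.filter_append, List.map_append, List.map_append, List.sum_append,
    List.sum_append, List.map_reverse, List.filter_reverse, List.map_reverse, List.sum_reverse]
  omega

theorem cumDegree_mmProgram_le {k : ℕ} (hk : 0 < k) (a e n : ℕ) :
    ((((mmProgram k).fold e).cumDegree a n : ℕ) : ℝ) ≤ 15 * 2 ^ e * labelWeight n := by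
  have h : ((mmProgram k).fold e).cumDegree a n
      ≤ 3 * if 3 ∣ n then 5 * 2 ^ (n / 3 + e) else 0 :=
    sum_stepsWithLabel_le (((mmProgram k).fold e).degree a) (fun i => 5 * 2 ^ (i + e))
      (fun i hi => degree_mmDown_le hi a e) (fun i hi => degree_mmUp_le hi a e)
      (by simpa using degree_mmFinal_le hk a e)
  refine (Nat.cast_le.2 h).trans (le_of_eq ?_)
  unfold labelWeight
  split_ifs
  · push_cast; ring
  · simp

theorem numSteps_mmProgram_le (k e n : ℕ) :
    ((((mmProgram k).fold e).numSteps n : ℕ) : ℝ) ≤ 3 * labelWeight n := by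
  have h : ((mmProgram k).fold e).numSteps n ≤ 3 * if 3 ∣ n then 1 else 0 := by
    have := sum_stepsWithLabel_le (k := k) (e := e) (n := n) (fun _ => 1) (fun _ => 1)
      (fun _ _ => le_rfl) (fun _ _ => le_rfl) le_rfl
    have hlen : ∀ l : List (Superstep MMCell), (l.map fun _ => 1).sum = l.length := by simp
    exact (hlen _).symm.trans_le this
  refine (Nat.cast_le.2 h).trans ?_
  unfold labelWeight
  split_ifs
  · push_cast
    have : (1 : ℝ) ≤ 2 ^ (n / 3) := one_le_pow₀ (by norm_num)
    linarith
  · simp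

/-- Upper bound for the communication time of the foldings of the recursive algorithm. -/
theorem commTime_mmProgram_le {K : ℝ} (hK0 : 0 ≤ K) {k a : ℕ} (ha : 0 < a) (hak : a ≤ 2 * k)
    (g ℓ : Fin a → ℝ) (hg : ∀ i, 0 < g i) (hanti : Antitone fun i => ℓ i / g i)
    (hK : ℓ ⟨0, ha⟩ / g ⟨0, ha⟩ ≤ K * ((4 : ℝ) ^ k / 2 ^ a)) :
    ((mmProgram k).fold (2 * k - a)).commTime a g ℓ
      ≤ (15 + 3 * K) * ((4 : ℝ) ^ k / 2 ^ a) * ∑ i : Fin a, labelWeight i * g i := by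
  have hk : 0 < k := by omega
  have he : (2 : ℝ) ^ (2 * k - a) = 4 ^ k / 2 ^ a := by
    rw [eq_div_iff (by positivity), ← pow_add, Nat.sub_add_cancel hak, pow_mul]
    norm_num
  rw [Finset.mul_sum]
  refine Finset.sum_le_sum fun i _ => ?_
  have h1 := mul_le_mul_of_nonneg_right (cumDegree_mmProgram_le hk a (2 * k - a) i) (hg i).le
  -- Since ℓ/g is non-increasing, the bound assumed at label 0 holds at all labels; latency is then
  -- paid for by the weights, which are at least 1 at every label in use.
  have hℓ : ℓ i ≤ K * ((4 : ℝ) ^ k / 2 ^ a) * g i := by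
    rw [← div_le_iff₀ (hg i)]
    exact (hanti (Fin.mk_le_mk.2 (Nat.zero_le i) : (⟨0, ha⟩ : Fin a) ≤ i)).trans hK
  have hw := labelWeight_nonneg i
  have h2 := mul_le_mul (numSteps_mmProgram_le k (2 * k - a) i) le_rfl
    (mul_nonneg (by positivity) (hg i).le : 0 ≤ K * ((4 : ℝ) ^ k / 2 ^ a) * g i) (by positivity)
  have h3 := mul_le_mul_of_nonneg_left hℓ
    (Nat.cast_nonneg (α := ℝ) (((mmProgram k).fold (2 * k - a)).numSteps i))
  rw [he] at h1
  calc _ ≤ _ := add_le_add h1 (h3.trans h2)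
    _ = _ := by ring

end Degrees

end NetworkOblivious

open NetworkOblivious
theorem mainTheorem4 (K : ℝ) (hK : 0 < K) :
    ∃ β : ℝ, 0 < β ∧ β ≤ 1 ∧
      ∀ (k a : ℕ) (ha : 0 < a), 2 ^ a ≤ 4 ^ k →
        ∀ g ℓ : Fin a → ℝ, (∀ i, 0 < g i) → (∀ i, 0 ≤ ℓ i) →
          Antitone g → Antitone (fun i => ℓ i / g i) →
          ℓ ⟨0, ha⟩ / g ⟨0, ha⟩ ≤ K * ((4 : ℝ) ^ k / 2 ^ a) →
          IsOptimal (MMClass a) a g ℓ β ((mmProgram k).fold (2 * k - a)) := by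
  -- The reciprocal of 1/β: 8100 from the lower bound for the class, 15 + 3K from the upper bound
  -- for the algorithm.
  refine ⟨1 / (8100 * (15 + 3 * K)), by positivity, ?_, ?_⟩
  · rw [div_le_one (by positivity)]
    linarith
  · intro k a ha hak g ℓ hg hℓ hanti hanti' h0
    have hak : a ≤ 2 * k := by
      rw [four_pow_eq] at hak
      exact (Nat.pow_le_pow_iff_right (by norm_num)).1 hak
    refine ⟨mmProgram_fold_mem ha hak, fun Q hQ => ?_⟩
    have hlow := hQ.commTime_ge (Nat.two_pow_pos k) g ℓ hg hℓ hanti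
    have h4 : (((2 ^ k : ℕ) : ℝ)) ^ 2 = 4 ^ k := by
      push_cast
      rw [← pow_mul, mul_comm, pow_mul]
      norm_num
    rw [h4] at hlow
    refine (commTime_mmProgram_le hK.le ha hak g ℓ hg hanti' h0).trans ?_
    rw [one_div_one_div]
    refine le_trans (le_of_eq ?_)
      (mul_le_mul_of_nonneg_left hlow (by positivity : 0 ≤ 8100 * (15 + 3 * K)))
    field_simp
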